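/- Consider a single bosonic mode, i.e. a complex Hilbert space $\mathcal H$ with a fixed orthonormal Fock basis $\{|n\rangle\}_{n\in\mathbb N}$ (for instance $L^2(\mathbb R)$ with the Hermite functions), with annihilation and creation operators $a|n\rangle=\sqrt n\,|n-1\rangle$, $a^\dagger|n\rangle=\sqrt{n+1}\,|n+1\rangle$, and $x^{a^\dagger a}|n\rangle=x^n|n\rangle$ (with $0^0=1$). Let $b,b^\dagger$ be the corresponding operators of an environment mode $E$, with vacuum $|0\rangle_E$. For $\lambda\in[0,1]$ and $g\ge1$ define, on trace-class operators $\rho$ on $\mathcal H$, the pure loss channel and the pure amplifier channel $$\mathcal E_{\lambda,0}(\rho)=\mathrm{Tr}_E\!\left[U_\lambda(\rho\otimes|0\rangle\langle0|_E)U_\lambda^\dagger\right],\quad U_\lambda=\exp\!\left[\arccos\sqrt\lambda\,(a^\dagger b-ab^\dagger)\right],$$ $$\Phi_{g,0}(\rho)=\mathrm{Tr}_E\!\left[U_g(\rho\otimes|0\rangle\langle0|_E)U_g^\dagger\right],\quad U_g=\exp\!\left[\mathrm{arccosh}\sqrt g\,(a^\dagger b^\dagger-ab)\right],$$ and let $\mathcal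 N_{g,\lambda}=\Phi_{g,0}\circ\mathcal E_{\lambda,0}$. **Theorem.** Let $\lambda\in[0,1]$ and $g\ge 1$. For $k,m\in\mathbb N$ the expressions $$M_k^{\rm amp}=\frac1{\sqrt{g\,k!}}\left(\sqrt{\tfrac{g-1}g}\right)^{k}(a^\dagger)^k\left(\tfrac1{\sqrt g}\right)^{a^\dagger a},\qquad M_m^{\rm loss}=\sqrt{\frac{(1-\lambda)^m}{m!}}\,(\sqrt\lambda)^{a^\dagger a}a^m ,$$ defined on finite linear combinations of Fock states, extend to bounded operators on $\mathcal H$, which are Kraus operators of $\Phi_{g,0}$ and $\mathcal E_{\lambda,0}$ respectively: $$\Phi_{g,0}(\rho)=\sum_{k=0}^\infty M_k^{\rm amp}\rho\,(M_k^{\rm amp})^\dagger,\qquad \mathcal E_{\lambda,0}(\rho)=\sum_{m=0}^\infty M_m^{\rm loss}\rho\,(M_m^{\rm loss})^\dagger .$$ Their products satisfy, on finite linear combinations of Fock states, $$M_{k,m}:=M_k^{\rm amp}M_m^{\rm loss}=\sqrt{\frac{(g-1)^k(1-\lambda)^m}{k!\,m!\,g^{k+1}}}\;(a^\dagger)^k\left(\sqrt{\tfrac{\lambda}{g}}\right)^{a^\dagger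 a}a^m ,$$ and for every trace-class operator $\rho$ (in particular for every state) $$\mathcal N_{g,\lambda}(\rho)=\sum_{k,m=0}^\infty M_{k,m}\,\rho\,M_{k,m}^\dagger .$$ In particular, for all $n,i\in\mathbb N$, $$\mathcal N_{g,\lambda}(|n\rangle\langle i|)=\sum_{l=\max(i-n,0)}^\infty f_{n,i,l}(g,\lambda)\,|l+n-i\rangle\langle l| ,$$ $$f_{n,i,l}(g,\lambda)=\sum_{m=\max(i-l,0)}^{\min(n,i)}\frac{\sqrt{n!\,i!\,l!\,(l+n-i)!}}{(n-m)!\,(i-m)!\,m!\,(l+m-i)!}\;\frac{(g-1)^{l+m-i}(1-\lambda)^m\lambda^{\frac{n+i-2m}2}}{g^{\,l+1+\frac{n-i}2}}$$ (with $0^0=1$). All the series of operators converge unconditionally in trace norm. -/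

import Mathlib

noncomputable section

namespace Bosonic

open scoped TensorProduct ENNReal
open Filter Topology

/-! ### Ladder operators on the finite-particle vectors

A single bosonic mode is a complex Hilbert space `H` with its Fock basis `|0⟩, |1⟩, …`, given as a
`HilbertBasis ℕ ℂ H`. (For `H = L²(ℝ)` these are the Hermite functions.) The ladder operators act
on the dense invariant domain of finite linear combinations of Fock states; such a combination is
recorded by its coefficients, an element of `ℕ →₀ ℂ`. -/

/-- The annihilation operator: `a |n⟩ = √n |n - 1⟩` (so `a |0⟩ = 0`). -/
def annihilate : (ℕ →₀ ℂ) →ₗ[ℂ] (ℕ →₀ ℂ) :=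
  Finsupp.linearCombination ℂ fun n : ℕ => Finsupp.single (n - 1) ((√(n : ℝ) : ℝ) : ℂ)

/-- The creation operator: `a† |n⟩ = √(n + 1) |n + 1⟩`. -/
def create : (ℕ →₀ ℂ) →ₗ[ℂ] (ℕ →₀ ℂ) :=
  Finsupp.linearCombination ℂ fun n : ℕ => Finsupp.single (n + 1) ((√((n : ℝ) + 1) : ℝ) : ℂ)

/-- The function `x ^ (a† a)` of the photon number operator: `x ^ (a† a) |n⟩ = x ^ n |n⟩`
(with `0 ^ 0 = 1`). -/
def numberPow (x : ℝ) : (ℕ →₀ ℂ) →ₗ[ℂ] (ℕ →₀ ℂ) :=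
  Finsupp.linearCombination ℂ fun n : ℕ => Finsupp.single n ((x ^ n : ℝ) : ℂ)

section General

variable {D K : Type*} [AddCommGroup D] [Module ℂ D]
  [NormedAddCommGroup K] [InnerProductSpace ℂ K] [CompleteSpace K]

/-- `U` is a strongly continuous one-parameter unitary group on `K` whose generator extends the
operator `A` with domain `D`, where `D` is regarded as a subspace of `K` through `j`. -/
structure IsUnitaryGroupGeneratedBy (j : D →ₗ[ℂ] K) (A : D →ₗ[ℂ] D) (U : ℝ → K →L[ℂ] K) :
    Prop where
  mem_unitary : ∀ t, U t ∈ unitary (K →L[ℂ] K)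
  map_zero : U 0 = 1
  map_add : ∀ s t, U (s + t) = U s * U t
  continuous : ∀ ψ : K, Continuous fun t => U t ψ
  hasDerivAt : ∀ v : D, HasDerivAt (fun t => U t (j v)) (j (A v)) 0

open Classical in
/-- The unitary operator `exp (t A)` for an operator `A` on the dense domain `D` of `K` that is
essentially skew-adjoint: the value at time `t` of the strongly continuous one-parameter unitary
group generated by `A` (which is then unique, by Stone's theorem). -/
def unitaryExp (j : D →ₗ[ℂ] K) (A : D →ₗ[ℂ] D) (t : ℝ) : K →L[ℂ] K :=
  if h : ∃ U, IsUnitaryGroupGeneratedBy j A U then h.choose t else 0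

end General

variable {H : Type*} [NormedAddCommGroup H] [InnerProductSpace ℂ H] [CompleteSpace H]

/-- The vector `∑ₙ vₙ |n⟩` of the mode with the finitely many nonzero coefficients `vₙ`. -/
def toMode (fock : HilbertBasis ℕ ℂ H) : (ℕ →₀ ℂ) →ₗ[ℂ] H :=
  Finsupp.linearCombination ℂ fock

/-- The bounded operator on the mode that extends an operator given on the finite-particle
vectors (when that one is bounded). -/
def boundedExtension (fock : HilbertBasis ℕ ℂ H) (T : (ℕ →₀ ℂ) →ₗ[ℂ] (ℕ →₀ ℂ)) : H →L[ℂ] H :=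
  (toMode fock ∘ₗ T).extendOfNorm (toMode fock)

/-- The operator `|n⟩⟨i|`. -/
def ketBra (fock : HilbertBasis ℕ ℂ H) (n i : ℕ) : H →L[ℂ] H :=
  InnerProductSpace.rankOne ℂ (fock n) (fock i)

/-! ### Trace norm -/

/-- The trace norm `‖T‖₁ = Tr √(T† T)`, as an extended nonnegative number. -/
def traceNorm (fock : HilbertBasis ℕ ℂ H) (T : H →L[ℂ] H) : ℝ≥0∞ :=
  ∑' n, ENNReal.ofReal (inner ℂ (fock n) (CFC.abs T (fock n))).re

/-- Trace-class operators. -/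
def IsTraceClass (fock : HilbertBasis ℕ ℂ H) (T : H →L[ℂ] H) : Prop :=
  traceNorm fock T < ∞

/-- `∑ i, F i = S`, the sum being unconditionally convergent in trace norm. -/
def HasTraceNormSum (fock : HilbertBasis ℕ ℂ H) {ι : Type*} (F : ι → H →L[ℂ] H)
    (S : H →L[ℂ] H) : Prop :=
  Tendsto (fun s : Finset ι => traceNorm fock (S - ∑ i ∈ s, F i)) atTop (𝓝 0)

/-! ### System and environment -/

variable (H) in
/-- The Hilbert space tensor product of the system mode (first factor) and the environment mode
(second factor). -/
abbrev TwoMode : Type _ := UniformSpace.Completion (H ⊗[ℂ] H)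

/-- The bounded operator `A ⊗ B` on the two modes. -/
def tensorOp (A B : H →L[ℂ] H) : TwoMode H →L[ℂ] TwoMode H :=
  (TensorProduct.mapL A B).completion

/-- The operator `ψ ↦ ψ ⊗ φ`. -/
def tensorRight (φ : H) : H →L[ℂ] TwoMode H :=
  UniformSpace.Completion.toComplL ∘L (TensorProduct.mkL ℂ H H).flip φ

/-- The partial trace over the environment,
`⟨ψ, (Tr_E X) ψ'⟩ = ∑ⱼ ⟨ψ ⊗ |j⟩, X (ψ' ⊗ |j⟩)⟩`. -/
def partialTrace (fock : HilbertBasis ℕ ℂ H) (X : TwoMode H →L[ℂ] TwoMode H) : H →L[ℂ] H :=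
  ∑' j : ℕ, (tensorRight (fock j)).adjoint ∘L X ∘L tensorRight (fock j)

/-- The vector `∑ v₍ₙ,ₘ₎ |n⟩ ⊗ |m⟩` of the two modes with finitely many nonzero coefficients. -/
def toTwoMode (fock : HilbertBasis ℕ ℂ H) : (ℕ × ℕ →₀ ℂ) →ₗ[ℂ] TwoMode H :=
  Finsupp.linearCombination ℂ fun p : ℕ × ℕ => tensorRight (fock p.2) (fock p.1)

/-- The annihilation operator `a` of the system: `a |n, m⟩ = √n |n - 1, m⟩`. -/
def annihilateS : (ℕ × ℕ →₀ ℂ) →ₗ[ℂ] (ℕ × ℕ →₀ ℂ) :=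
  Finsupp.linearCombination ℂ fun p : ℕ × ℕ =>
    Finsupp.single (p.1 - 1, p.2) ((√(p.1 : ℝ) : ℝ) : ℂ)

/-- The creation operator `a†` of the system: `a† |n, m⟩ = √(n + 1) |n + 1, m⟩`. -/
def createS : (ℕ × ℕ →₀ ℂ) →ₗ[ℂ] (ℕ × ℕ →₀ ℂ) :=
  Finsupp.linearCombination ℂ fun p : ℕ × ℕ =>
    Finsupp.single (p.1 + 1, p.2) ((√((p.1 : ℝ) + 1) : ℝ) : ℂ)

/-- The annihilation operator `b` of the environment: `b |n, m⟩ = √m |n, m - 1⟩`. -/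
def annihilateE : (ℕ × ℕ →₀ ℂ) →ₗ[ℂ] (ℕ × ℕ →₀ ℂ) :=
  Finsupp.linearCombination ℂ fun p : ℕ × ℕ =>
    Finsupp.single (p.1, p.2 - 1) ((√(p.2 : ℝ) : ℝ) : ℂ)

/-- The creation operator `b†` of the environment: `b† |n, m⟩ = √(m + 1) |n, m + 1⟩`. -/
def createE : (ℕ × ℕ →₀ ℂ) →ₗ[ℂ] (ℕ × ℕ →₀ ℂ) :=
  Finsupp.linearCombination ℂ fun p : ℕ × ℕ =>
    Finsupp.single (p.1, p.2 + 1) ((√((p.2 : ℝ) + 1) : ℝ) : ℂ)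

/-- The operator `a† b - a b†`. -/
def beamSplitterGen : (ℕ × ℕ →₀ ℂ) →ₗ[ℂ] (ℕ × ℕ →₀ ℂ) :=
  createS * annihilateE - annihilateS * createE

/-- The operator `a† b† - a b`. -/
def squeezingGen : (ℕ × ℕ →₀ ℂ) →ₗ[ℂ] (ℕ × ℕ →₀ ℂ) :=
  createS * createE - annihilateS * annihilateE

/-- The beam splitter unitary `exp (arccos √lam (a† b - a b†))` of transmissivity `lam`. -/
def beamSplitter (fock : HilbertBasis ℕ ℂ H) (lam : ℝ) : TwoMode H →L[ℂ] TwoMode H :=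
  unitaryExp (toTwoMode fock) beamSplitterGen (Real.arccos √lam)

/-- The two-mode squeezing unitary `exp (arcosh √g (a† b† - a b))` of gain `g`. -/
def twoModeSqueezer (fock : HilbertBasis ℕ ℂ H) (g : ℝ) : TwoMode H →L[ℂ] TwoMode H :=
  unitaryExp (toTwoMode fock) squeezingGen (Real.arcosh √g)

/-- The thermal state `τ_ν = (1 / (ν + 1)) ∑ₙ (ν / (ν + 1)) ^ n |n⟩⟨n|`. -/
def thermalState (fock : HilbertBasis ℕ ℂ H) (ν : ℝ) : H →L[ℂ] H :=
  ∑' n : ℕ, (((1 / (ν + 1)) * (ν / (ν + 1)) ^ n : ℝ) : ℂ) • ketBra fock n n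

/-- The thermal attenuator `ρ ↦ Tr_E [U (ρ ⊗ τ_ν) U†]`, `U` the beam splitter. -/
def thermalAttenuator (fock : HilbertBasis ℕ ℂ H) (lam ν : ℝ) (ρ : H →L[ℂ] H) : H →L[ℂ] H :=
  partialTrace fock
    (beamSplitter fock lam ∘L tensorOp ρ (thermalState fock ν) ∘L (beamSplitter fock lam).adjoint)

/-- The thermal amplifier `ρ ↦ Tr_E [U (ρ ⊗ τ_ν) U†]`, `U` the two-mode squeezer. -/
def thermalAmplifier (fock : HilbertBasis ℕ ℂ H) (g ν : ℝ) (ρ : H →L[ℂ] H) : H →L[ℂ] H :=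
  partialTrace fock
    (twoModeSqueezer fock g ∘L tensorOp ρ (thermalState fock ν) ∘L
      (twoModeSqueezer fock g).adjoint)

/-- The composition `Φ_{g,0} ∘ E_{lam,0}` of pure loss followed by pure amplification. -/
def compChannel (fock : HilbertBasis ℕ ℂ H) (g lam : ℝ) : (H →L[ℂ] H) → H →L[ℂ] H :=
  thermalAmplifier fock g 0 ∘ thermalAttenuator fock lam 0

/-! ### Kraus operators -/

/-- `(1 / √(g k!)) √((g - 1) / g) ^ k (a†) ^ k (1 / √g) ^ (a† a)` on finite-particle vectors. -/
def pureAmpExpr (g : ℝ) (k : ℕ) : (ℕ →₀ ℂ) →ₗ[ℂ] (ℕ →₀ ℂ) :=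
  ((1 / √(g * (k.factorial : ℝ)) * √((g - 1) / g) ^ k : ℝ) : ℂ) •
    (create ^ k * numberPow (1 / √g))

/-- `√((1 - lam) ^ m / m!) (√lam) ^ (a† a) a ^ m` on finite-particle vectors. -/
def pureLossExpr (lam : ℝ) (m : ℕ) : (ℕ →₀ ℂ) →ₗ[ℂ] (ℕ →₀ ℂ) :=
  ((√((1 - lam) ^ m / (m.factorial : ℝ)) : ℝ) : ℂ) • (numberPow √lam * annihilate ^ m)

/-- `√((g - 1) ^ k (1 - lam) ^ m / (k! m! g ^ (k + 1))) (a†) ^ k √(lam / g) ^ (a† a) a ^ m` on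
finite-particle vectors. -/
def compExpr (g lam : ℝ) (k m : ℕ) : (ℕ →₀ ℂ) →ₗ[ℂ] (ℕ →₀ ℂ) :=
  ((√((g - 1) ^ k * (1 - lam) ^ m / ((k.factorial : ℝ) * (m.factorial : ℝ) * g ^ (k + 1))) : ℝ)
    : ℂ) • (create ^ k * numberPow √(lam / g) * annihilate ^ m)

/-- The Kraus operators of the pure amplifier. -/
def krausPureAmp (fock : HilbertBasis ℕ ℂ H) (g : ℝ) (k : ℕ) : H →L[ℂ] H :=
  boundedExtension fock (pureAmpExpr g k)

/-- The Kraus operators of the pure loss channel. -/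
def krausPureLoss (fock : HilbertBasis ℕ ℂ H) (lam : ℝ) (m : ℕ) : H →L[ℂ] H :=
  boundedExtension fock (pureLossExpr lam m)

/-- The Kraus operators of the composition. -/
def krausComp (fock : HilbertBasis ℕ ℂ H) (g lam : ℝ) (k m : ℕ) : H →L[ℂ] H :=
  krausPureAmp fock g k ∘L krausPureLoss fock lam m

/-- The coefficient of `|l + n - i⟩⟨l|` in the image of `|n⟩⟨i|`; meant for `l + n ≥ i`, where no
natural subtraction below is truncated, except that the lower limit is `max (i - l) 0`. -/
def fockCoeff (n i l : ℕ) (g lam : ℝ) : ℝ :=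
  ∑ m ∈ Finset.Icc (i - l) (min n i),
    √((n.factorial : ℝ) * (i.factorial : ℝ) * (l.factorial : ℝ) * ((l + n - i).factorial : ℝ)) /
        (((n - m).factorial : ℝ) * ((i - m).factorial : ℝ) * (m.factorial : ℝ) *
          ((l + m - i).factorial : ℝ)) *
      ((g - 1) ^ (l + m - i) * (1 - lam) ^ m * lam ^ (((n : ℝ) + i - 2 * m) / 2) /
        g ^ ((l : ℝ) + 1 + ((n : ℝ) - i) / 2))

end Bosonic

end

noncomputable section

namespace Bosonic

open scoped TensorProduct ENNReal
open Filter Topology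

variable {H : Type*} [NormedAddCommGroup H] [InnerProductSpace ℂ H] [CompleteSpace H]

/-! ### Trace norm and sums of rank-one operators -/

/-! With a vacuum environment, `Tr_E [U (ρ ⊗ |0⟩⟨0|) U†]` is literally `∑ⱼ Kⱼ ρ Kⱼ†` with `Kⱼ =
⟨j|_E U |0⟩_E` (`vacuumKraus`, `partialTrace_vacuum`). So the proof has to compute `U (|n⟩ ⊗ |0⟩)`
for the two unitaries, compare the result with the explicit expressions, and control convergence.

The unitaries are abstract: `unitaryExp` picks some group with the given generator and is `0` if
there is none. Existence comes from analytic vectors: on states with at most `N` photons the `k`-th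
power of a generator has norm at most `2 ^ k (k + N)! / N!`, so the exponential series converges for
small times and is isometric there, and the short-time operators are multiplied up to a group
(`IsAnalyticSkew`). The orbit of `|n⟩ ⊗ |0⟩` is then identified by guessing a solution of `u' = A u`
and bounding the defect of the guess (`IsUnitaryGroupGeneratedBy.norm_sub_le`). For the beam
splitter the guess is a finite binomial sum with no defect. For the squeezer it is an infinite sum
in powers of `tanh t`; cutting it at `N` leaves two boundary terms, which tend to `0` uniformly on
compact time intervals.

The expressions thus agree on Fock states with `Kⱼ`, up to a sign for loss, and `Kⱼ` is bounded
because `U` is. This settles boundedness.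

For convergence, a trace-class `ρ` is written as `∑ₐ |xₐ⟩⟨yₐ|` with `∑ₐ ‖xₐ‖ ‖yₐ‖ < ∞`. Since `∑ Kᵢ†
Kᵢ ≤ 1`, Cauchy–Schwarz makes the family `|Kᵢ xₐ⟩⟨Kᵢ yₐ|` summable in the same sense. Hence its
terms may be regrouped in any way, with trace-norm convergence (`hasTraceNormSum_of_fibers`).
Grouping by Kraus index gives the Kraus series, regrouping pairs gives the composition, and grouping
by output Fock operator gives `fockCoeff`. -/

theorem norm_cfcAbs_apply (T : H →L[ℂ] H) (x : H) : ‖CFC.abs T x‖ = ‖T x‖ := by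
  have hsa : IsSelfAdjoint (CFC.abs T) := (CFC.abs_nonneg T).isSelfAdjoint
  have h : inner ℂ (CFC.abs T x) (CFC.abs T x) = inner ℂ (T x) (T x) := by
    rw [← ContinuousLinearMap.adjoint_inner_right, ← ContinuousLinearMap.adjoint_inner_right T]
    have h1 : CFC.abs T (CFC.abs T x) = (star T) (T x) :=
      congrArg (fun S : H →L[ℂ] H => S x) (CFC.abs_mul_abs T)
    rw [← ContinuousLinearMap.star_eq_adjoint, ← ContinuousLinearMap.star_eq_adjoint, hsa.star_eq,
      h1]
  rw [inner_self_eq_norm_sq_to_K, inner_self_eq_norm_sq_to_K] at h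
  have h2 : ‖CFC.abs T x‖ ^ 2 = ‖T x‖ ^ 2 := by exact_mod_cast h
  exact (sq_eq_sq₀ (norm_nonneg _) (norm_nonneg _)).1 h2

/-- The polar decomposition. -/
theorem exists_polar (T : H →L[ℂ] H) : ∃ W : H →L[ℂ] H, ‖W‖ ≤ 1 ∧
    (∀ x, W (CFC.abs T x) = T x) ∧ ∀ x, W.adjoint (T x) = CFC.abs T x := by
  set P := CFC.abs T
  let S : Submodule ℂ H := P.range.topologicalClosure
  have : CompleteSpace S := P.range.isClosed_topologicalClosure.completeSpace_coe
  let e : H →ₗ[ℂ] S := P.toLinearMap.codRestrict S fun x =>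
    P.range.le_topologicalClosure ⟨x, rfl⟩
  have he : DenseRange e := by
    rw [DenseRange, dense_iff_closure_eq, Set.eq_univ_iff_forall]
    rintro ⟨x, hx⟩
    rw [closure_subtype]
    have : (Subtype.val '' Set.range e) = (P.range : Set H) := by
      ext y; simp [e]
    rw [this]; exact hx
  have hb : ∀ x, ‖T x‖ ≤ 1 * ‖e x‖ := fun x => by
    rw [one_mul]; exact (norm_cfcAbs_apply T x).ge
  let W0 : S →L[ℂ] H := T.toLinearMap.extendOfNorm e
  have hW0 : ‖W0‖ ≤ 1 := LinearMap.opNorm_extendOfNorm_le he zero_le_one hb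
  let W : H →L[ℂ] H := W0 ∘L S.orthogonalProjectionOnto
  have hW : ‖W‖ ≤ 1 := (ContinuousLinearMap.opNorm_comp_le _ _).trans
    (mul_le_one₀ hW0 (norm_nonneg _) S.orthogonalProjectionOnto_norm_le)
  have hWP : ∀ x, W (P x) = T x := fun x => by
    have h1 : S.orthogonalProjectionOnto (P x) = e x :=
      S.orthogonalProjectionOnto_mem_subspace_eq_self (e x)
    simp only [W, ContinuousLinearMap.comp_apply, h1]
    exact LinearMap.extendOfNorm_eq he ⟨1, hb⟩ x
  refine ⟨W, hW, hWP, fun x => ?_⟩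
  have hn : ‖W.adjoint (T x)‖ ≤ ‖T x‖ := by
    have := W.adjoint.le_opNorm (T x)
    rw [LinearIsometryEquiv.norm_map] at this
    exact this.trans (mul_le_of_le_one_left (norm_nonneg _) hW)
  have hi : RCLike.re (inner ℂ (W.adjoint (T x)) (P x)) = ‖T x‖ ^ 2 := by
    rw [ContinuousLinearMap.adjoint_inner_left, hWP, inner_self_eq_norm_sq]
  have h3 := @norm_sub_sq ℂ H _ _ _ (W.adjoint (T x)) (P x)
  rw [hi, norm_cfcAbs_apply] at h3
  -- Equality case of Cauchy–Schwarz: both vectors have norm at most `‖T x‖` and the real part of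
  -- their inner product is `‖T x‖ ^ 2`, so they coincide.
  have h4 : ‖W.adjoint (T x) - P x‖ ^ 2 ≤ 0 := by nlinarith [norm_nonneg (W.adjoint (T x))]
  have h5 : ‖W.adjoint (T x) - P x‖ = 0 := by nlinarith [norm_nonneg (W.adjoint (T x) - P x)]
  exact sub_eq_zero.1 (norm_eq_zero.1 h5)

omit [CompleteSpace H] in
-- Cauchy–Schwarz for the coefficient sequences, followed by Bessel's inequality for each vector.
theorem tsum_enorm_inner_mul_enorm_inner_le (fock : HilbertBasis ℕ ℂ H) (x y : H) :
    ∑' n, ‖inner ℂ (fock n) x‖ₑ * ‖inner ℂ y (fock n)‖ₑ ≤ ENNReal.ofReal (‖x‖ * ‖y‖) := by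
  refine ENNReal.tsum_le_of_sum_range_le fun N => ?_
  have h1 : ∀ z : H, ∑ n ∈ Finset.range N, ‖inner ℂ (fock n) z‖ ^ 2 ≤ ‖z‖ ^ 2 := fun z =>
    fock.orthonormal.sum_inner_products_le z
  have h2 : ∑ n ∈ Finset.range N, ‖inner ℂ (fock n) x‖ * ‖inner ℂ y (fock n)‖ ≤ ‖x‖ * ‖y‖ := by
    refine (Real.sum_mul_le_sqrt_mul_sqrt _ _ _).trans ?_
    gcongr
    · exact Real.sqrt_le_iff.2 ⟨norm_nonneg _, h1 x⟩
    · refine Real.sqrt_le_iff.2 ⟨norm_nonneg _, ?_⟩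
      simpa only [norm_inner_symm y] using h1 y
  calc _ = ENNReal.ofReal
        (∑ n ∈ Finset.range N, ‖inner ℂ (fock n) x‖ * ‖inner ℂ y (fock n)‖) := by
        rw [ENNReal.ofReal_sum_of_nonneg fun _ _ => by positivity]
        simp only [ENNReal.ofReal_mul (norm_nonneg _), ofReal_norm]
    _ ≤ _ := ENNReal.ofReal_le_ofReal h2

theorem summable_rankOne {α : Type*} {x y : α → H} (h : Summable fun a => ‖x a‖ * ‖y a‖) :
    Summable fun a => InnerProductSpace.rankOne ℂ (x a) (y a) :=
  Summable.of_norm (by simpa only [InnerProductSpace.norm_rankOne] using h)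

/-- By polar decomposition `|T| = W† T = ∑ₐ |W† xₐ⟩⟨yₐ|` with `‖W‖ ≤ 1`. Taking diagonal entries and
exchanging the two sums leaves one Cauchy–Schwarz estimate for each `a`. -/
theorem traceNorm_le_of_hasSum (fock : HilbertBasis ℕ ℂ H) {α : Type*} {x y : α → H}
    {T : H →L[ℂ] H} (hT : HasSum (fun a => InnerProductSpace.rankOne ℂ (x a) (y a)) T) :
    traceNorm fock T ≤ ∑' a, ENNReal.ofReal (‖x a‖ * ‖y a‖) := by
  obtain ⟨W, hW, -, hWT⟩ := exists_polar T
  have key : ∀ n, ENNReal.ofReal (inner ℂ (fock n) (CFC.abs T (fock n))).re ≤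
      ∑' a, ‖inner ℂ (fock n) (W.adjoint (x a))‖ₑ * ‖inner ℂ (y a) (fock n)‖ₑ := fun n => by
    have h1 : HasSum (fun a => inner ℂ (fock n) (W.adjoint (x a)) * inner ℂ (y a) (fock n))
        (inner ℂ (fock n) (CFC.abs T (fock n))) := by
      rw [← hWT]
      have h2 := ((innerSL ℂ (fock n)).comp W.adjoint).hasSum
        ((ContinuousLinearMap.apply ℂ H (fock n)).hasSum hT)
      simpa [mul_comm] using h2
    rw [← h1.tsum_eq]
    calc _ ≤ ‖∑' a, inner ℂ (fock n) (W.adjoint (x a)) * inner ℂ (y a) (fock n)‖ₑ := by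
          rw [← ofReal_norm]
          exact ENNReal.ofReal_le_ofReal (Complex.re_le_norm _)
      _ ≤ ∑' a, ‖inner ℂ (fock n) (W.adjoint (x a)) * inner ℂ (y a) (fock n)‖ₑ :=
          enorm_tsum_le_tsum_enorm
      _ = _ := by simp only [enorm_mul]
  calc traceNorm fock T ≤ ∑' n, ∑' a, ‖inner ℂ (fock n) (W.adjoint (x a))‖ₑ *
        ‖inner ℂ (y a) (fock n)‖ₑ := ENNReal.tsum_le_tsum key
    _ = ∑' a, ∑' n, ‖inner ℂ (fock n) (W.adjoint (x a))‖ₑ * ‖inner ℂ (y a) (fock n)‖ₑ :=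
        ENNReal.tsum_comm
    _ ≤ ∑' a, ENNReal.ofReal (‖x a‖ * ‖y a‖) := ENNReal.tsum_le_tsum fun a => by
        refine (tsum_enorm_inner_mul_enorm_inner_le fock _ _).trans
          (ENNReal.ofReal_le_ofReal ?_)
        gcongr
        have := W.adjoint.le_opNorm (x a)
        rw [LinearIsometryEquiv.norm_map] at this
        exact this.trans (mul_le_of_le_one_left (norm_nonneg _) hW)

/-- A trace-class operator is a sum of rank-one operators with summable norms. -/
theorem IsTraceClass.exists_hasSum {fock : HilbertBasis ℕ ℂ H} {T : H →L[ℂ] H}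
    (hT : IsTraceClass fock T) : ∃ x y : ℕ → H, (Summable fun n => ‖x n‖ * ‖y n‖) ∧
      HasSum (fun n => InnerProductSpace.rankOne ℂ (x n) (y n)) T := by
  obtain ⟨W, hW, hWP, -⟩ := exists_polar T
  -- With `Q = √|T|`, finite trace norm says `∑ ‖Q |n⟩‖ ^ 2 < ∞`. Expanding the middle of `T = W Q
  -- Q` in the Fock basis gives `T = ∑ₙ |W Q n⟩⟨Q n|`.
  set Q := CFC.sqrt (CFC.abs T)
  have hQ : IsSelfAdjoint Q := (CFC.sqrt_nonneg _).isSelfAdjoint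
  have hQQ : ∀ x, Q (Q x) = CFC.abs T x := fun x => by
    have := CFC.sqrt_mul_sqrt_self (CFC.abs T) (CFC.abs_nonneg T)
    exact congrArg (fun S : H →L[ℂ] H => S x) this
  have hQadj : Q.adjoint = Q := by rw [← ContinuousLinearMap.star_eq_adjoint, hQ.star_eq]
  have hQn : ∀ x, (inner ℂ x (CFC.abs T x)).re = ‖Q x‖ ^ 2 := fun x => by
    rw [← hQQ, ← ContinuousLinearMap.adjoint_inner_left, hQadj]
    exact inner_self_eq_norm_sq (𝕜 := ℂ) (Q x)
  have hs : Summable fun n => ‖Q (fock n)‖ ^ 2 := by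
    have h1 : ∑' n, ENNReal.ofReal (‖Q (fock n)‖ ^ 2) ≠ ∞ := by
      simp only [← hQn]; exact hT.ne
    have h2 := ENNReal.summable_toReal h1
    simpa only [ENNReal.toReal_ofReal (sq_nonneg _)] using h2
  have hs' : Summable fun n => ‖W (Q (fock n))‖ * ‖Q (fock n)‖ := by
    refine hs.of_nonneg_of_le (fun _ => by positivity) fun n => ?_
    rw [sq]
    gcongr
    exact (W.le_opNorm _).trans (mul_le_of_le_one_left (norm_nonneg _) hW)
  refine ⟨fun n => W (Q (fock n)), fun n => Q (fock n), hs', ?_⟩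
  have h1 := (summable_rankOne hs').hasSum
  convert h1 using 1
  refine ContinuousLinearMap.ext fun v => ?_
  have h2 := (ContinuousLinearMap.apply ℂ H v).hasSum h1
  have h3 := (W.comp Q).hasSum (fock.hasSum_repr (Q v))
  have h4 : (W.comp Q) (Q v) = T v := by
    rw [ContinuousLinearMap.comp_apply, hQQ, hWP]
  rw [h4] at h3
  refine h3.unique ?_
  refine h2.congr_fun fun n => ?_
  simp [← ContinuousLinearMap.adjoint_inner_right, hQadj, fock.repr_apply_apply]

/-- Grouping the terms of a sum of rank-one operators with summable norms yields a series that
converges unconditionally in trace norm. -/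
theorem hasTraceNormSum_of_fibers (fock : HilbertBasis ℕ ℂ H) {α ι : Type*} {x y : α → H}
    (h : Summable fun a => ‖x a‖ * ‖y a‖) (π : α → ι) {F : ι → H →L[ℂ] H}
    (hF : ∀ i, HasSum (Set.indicator (π ⁻¹' {i})
      fun a => InnerProductSpace.rankOne ℂ (x a) (y a)) (F i))
    {S : H →L[ℂ] H} (hS : HasSum (fun a => InnerProductSpace.rankOne ℂ (x a) (y a)) S) :
    HasTraceNormSum fock F S := by
  classical
  -- The remainder after the groups in `s` is the sum of the rank-one terms with `π a ∉ s`, so its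
  -- trace norm is at most a tail of a convergent numerical series.
  have key : ∀ s : Finset ι, traceNorm fock (S - ∑ i ∈ s, F i) ≤
      ENNReal.ofReal (∑' a, Set.indicator (π ⁻¹' s)ᶜ (fun a => ‖x a‖ * ‖y a‖) a) := fun s => by
    have h1 : HasSum (fun a => InnerProductSpace.rankOne ℂ
        (Set.indicator (π ⁻¹' s)ᶜ x a) (y a)) (S - ∑ i ∈ s, F i) := by
      refine (hS.sub (hasSum_sum fun i (_ : i ∈ s) => hF i)).congr_fun fun a => ?_
      simp only [Set.indicator_apply, Set.mem_preimage, Set.mem_singleton_iff, Set.mem_compl_iff,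
        Finset.mem_coe, Finset.sum_ite_eq]
      split_ifs <;> simp
    refine (traceNorm_le_of_hasSum fock h1).trans (le_of_eq ?_)
    rw [ENNReal.ofReal_tsum_of_nonneg]
    · refine tsum_congr fun a => ?_
      simp only [Set.indicator_apply]
      split_ifs <;> simp
    · exact fun a => Set.indicator_nonneg (fun _ _ => by positivity) a
    · exact h.indicator _
  have h0 : Tendsto (fun s : Finset ι => ENNReal.ofReal
      (∑' a, Set.indicator (π ⁻¹' s)ᶜ (fun a => ‖x a‖ * ‖y a‖) a)) atTop (𝓝 0) := by
    rw [← ENNReal.ofReal_zero]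
    refine ENNReal.tendsto_ofReal ?_
    rw [← tsum_zero (β := α)]
    refine tendsto_tsum_of_dominated_convergence h (fun a => ?_) (Eventually.of_forall ?_)
    · refine tendsto_const_nhds.congr' ?_
      filter_upwards [eventually_ge_atTop {π a}] with s hs
      rw [Set.indicator_of_notMem]
      simpa using hs
    · intro s a
      refine (norm_indicator_le_norm_self _ _).trans (le_of_eq ?_)
      rw [Real.norm_of_nonneg (by positivity)]
  exact tendsto_of_tendsto_of_tendsto_of_le_of_le tendsto_const_nhds h0 (fun _ => zero_le) key

/-! ### Kraus series of contractive families -/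

section Kraus

variable {ι α : Type*} {K : ι → H →L[ℂ] H}

theorem comp_rankOne_comp_adjoint (A : H →L[ℂ] H) (x y : H) :
    A ∘L InnerProductSpace.rankOne ℂ x y ∘L A.adjoint =
      InnerProductSpace.rankOne ℂ (A x) (A y) := by
  ext v
  simp [ContinuousLinearMap.adjoint_inner_right]

theorem HasSum.conj (A : H →L[ℂ] H) {f : α → H →L[ℂ] H} {ρ : H →L[ℂ] H} (h : HasSum f ρ) :
    HasSum (fun a => A ∘L f a ∘L A.adjoint) (A ∘L ρ ∘L A.adjoint) :=
  (h.mul_right A.adjoint).mul_left A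

/-- `∑ᵢ Kᵢ† Kᵢ ≤ 1`. -/
def IsContractiveFamily (K : ι → H →L[ℂ] H) : Prop :=
  ∀ (s : Finset ι) (x : H), ∑ i ∈ s, ‖K i x‖ ^ 2 ≤ ‖x‖ ^ 2

omit [CompleteSpace H] in
theorem IsContractiveFamily.sum_mul_le (hK : IsContractiveFamily K) (s : Finset ι) (x y : H) :
    ∑ i ∈ s, ‖K i x‖ * ‖K i y‖ ≤ ‖x‖ * ‖y‖ := by
  refine (Real.sum_mul_le_sqrt_mul_sqrt _ _ _).trans ?_
  gcongr
  · exact Real.sqrt_le_iff.2 ⟨norm_nonneg _, hK s x⟩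
  · exact Real.sqrt_le_iff.2 ⟨norm_nonneg _, hK s y⟩

omit [CompleteSpace H] in
-- A finite set of pairs lies in a rectangle; summing over `i` first for fixed `a` costs only `‖x a‖
-- * ‖y a‖`. This is the summability behind all regroupings of Kraus series.
theorem IsContractiveFamily.summable_mul (hK : IsContractiveFamily K) {x y : α → H}
    (h : Summable fun a => ‖x a‖ * ‖y a‖) :
    Summable fun p : ι × α => ‖K p.1 (x p.2)‖ * ‖K p.1 (y p.2)‖ := by
  classical
  refine summable_of_sum_le (c := ∑' a, ‖x a‖ * ‖y a‖) (fun _ => by positivity) fun u => ?_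
  calc _ ≤ ∑ p ∈ u.image Prod.fst ×ˢ u.image Prod.snd, ‖K p.1 (x p.2)‖ * ‖K p.1 (y p.2)‖ := by
        refine Finset.sum_le_sum_of_subset_of_nonneg Finset.subset_product fun _ _ _ => ?_
        positivity
    _ = ∑ a ∈ u.image Prod.snd, ∑ i ∈ u.image Prod.fst, ‖K i (x a)‖ * ‖K i (y a)‖ :=
        Finset.sum_product_right _ _ _
    _ ≤ ∑ a ∈ u.image Prod.snd, ‖x a‖ * ‖y a‖ := Finset.sum_le_sum fun a _ => hK.sum_mul_le _ _ _
    _ ≤ _ := h.sum_le_tsum _ fun _ _ => by positivity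

omit [CompleteSpace H] in
theorem IsContractiveFamily.summable_norm_mul_norm (hK : IsContractiveFamily K) (x y : H) :
    Summable fun i => ‖K i x‖ * ‖K i y‖ :=
  summable_of_sum_le (fun _ => by positivity) fun s => hK.sum_mul_le s x y

theorem IsContractiveFamily.hasSum_conj_rankOne (hK : IsContractiveFamily K) (x y : H) :
    HasSum (fun i => InnerProductSpace.rankOne ℂ (K i x) (K i y))
      (∑' i, K i ∘L InnerProductSpace.rankOne ℂ x y ∘L (K i).adjoint) := by
  simp only [comp_rankOne_comp_adjoint]
  exact (summable_rankOne (hK.summable_norm_mul_norm x y)).hasSum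

omit [CompleteSpace H] in
theorem IsContractiveFamily.prod {κ : Type*} {L : κ → H →L[ℂ] H} (hK : IsContractiveFamily K)
    (hL : IsContractiveFamily L) : IsContractiveFamily fun p : ι × κ => K p.1 ∘L L p.2 := by
  classical
  intro u x
  calc _ ≤ ∑ p ∈ u.image Prod.fst ×ˢ u.image Prod.snd, ‖(K p.1 ∘L L p.2) x‖ ^ 2 := by
        refine Finset.sum_le_sum_of_subset_of_nonneg Finset.subset_product fun _ _ _ => ?_
        positivity
    _ = ∑ j ∈ u.image Prod.snd, ∑ i ∈ u.image Prod.fst, ‖K i (L j x)‖ ^ 2 :=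
        Finset.sum_product_right _ _ _
    _ ≤ ∑ j ∈ u.image Prod.snd, ‖L j x‖ ^ 2 := Finset.sum_le_sum fun a _ => hK _ _
    _ ≤ _ := hL _ _

/-- The terms of a Kraus series are summable in operator norm. -/
theorem IsContractiveFamily.hasSum_rankOne (hK : IsContractiveFamily K) {x y : α → H}
    {ρ : H →L[ℂ] H} (h : Summable fun a => ‖x a‖ * ‖y a‖)
    (hρ : HasSum (fun a => InnerProductSpace.rankOne ℂ (x a) (y a)) ρ) :
    HasSum (fun p : ι × α => InnerProductSpace.rankOne ℂ (K p.1 (x p.2)) (K p.1 (y p.2)))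
      (∑' i, K i ∘L ρ ∘L (K i).adjoint) := by
  have h1 := (summable_rankOne (hK.summable_mul h)).hasSum
  have h2 := h1.prod_fiberwise (g := fun i => K i ∘L ρ ∘L (K i).adjoint) fun i => by
    simpa only [comp_rankOne_comp_adjoint] using HasSum.conj (K i) hρ
  rwa [h2.tsum_eq]

theorem IsContractiveFamily.hasTraceNormSum (hK : IsContractiveFamily K)
    (fock : HilbertBasis ℕ ℂ H) {x y : α → H}
    {ρ : H →L[ℂ] H} (h : Summable fun a => ‖x a‖ * ‖y a‖)
    (hρ : HasSum (fun a => InnerProductSpace.rankOne ℂ (x a) (y a)) ρ) :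
    HasTraceNormSum fock (fun i => K i ∘L ρ ∘L (K i).adjoint)
      (∑' i, K i ∘L ρ ∘L (K i).adjoint) := by
  refine hasTraceNormSum_of_fibers fock (hK.summable_mul h) Prod.fst (fun i => ?_)
    (hK.hasSum_rankOne h hρ)
  have h1 := HasSum.conj (K i) hρ
  simp only [comp_rankOne_comp_adjoint] at h1
  have h2 : Function.Injective (Prod.mk i : α → ι × α) := Prod.mk_right_injective i
  rw [← h2.hasSum_iff]
  · convert h1 using 2 with a
    simp
  · rintro ⟨j, a⟩ hj
    refine Set.indicator_of_notMem (fun hji => hj ⟨a, ?_⟩) _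
    simp only [Set.mem_preimage, Set.mem_singleton_iff] at hji
    rw [hji]

/-- The Kraus series of a composition. -/
theorem IsContractiveFamily.tsum_prod_eq {κ : Type*} {L : κ → H →L[ℂ] H}
    (hK : IsContractiveFamily K) (hL : IsContractiveFamily L) {x y : α → H}
    {ρ : H →L[ℂ] H} (h : Summable fun a => ‖x a‖ * ‖y a‖)
    (hρ : HasSum (fun a => InnerProductSpace.rankOne ℂ (x a) (y a)) ρ) :
    ∑' p : ι × κ, (K p.1 ∘L L p.2) ∘L ρ ∘L (K p.1 ∘L L p.2).adjoint =
      ∑' i, K i ∘L (∑' j, L j ∘L ρ ∘L (L j).adjoint) ∘L (K i).adjoint := by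
  have h1 := (hK.prod hL).hasSum_rankOne h hρ
  -- The double series is the same triple-indexed family of rank-one operators, bracketed as `ι × (κ
  -- × α)` instead of `(ι × κ) × α`.
  have h2 := hK.hasSum_rankOne (hL.summable_mul h) (hL.hasSum_rankOne h hρ)
  have h3 := (Equiv.prodAssoc ι κ α).hasSum_iff.2 h2
  exact h1.unique h3

end Kraus

/-! ### Unitary groups with a total set of analytic vectors -/

section Group

variable {D K : Type*} [AddCommGroup D] [Module ℂ D]
  [NormedAddCommGroup K] [InnerProductSpace ℂ K]

theorem mul_pow_div_factorial_antidiagonal (s t : ℝ) (n : ℕ) :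
    ∑ p ∈ Finset.HasAntidiagonal.antidiagonal n, s ^ p.1 / p.1.factorial * (t ^ p.2 / p.2.factorial) =
      (s + t) ^ n / n.factorial := by
  rw [(Commute.all s t).add_pow', Finset.sum_div]
  refine Finset.sum_congr rfl fun p hp => ?_
  obtain rfl := Finset.HasAntidiagonal.mem_antidiagonal.1 hp
  rw [nsmul_eq_mul, Nat.cast_choose ℝ (Nat.le_add_right _ _), Nat.add_sub_cancel_left]
  have := (p.1 + p.2).factorial_pos
  have h1 := p.1.factorial_pos
  have h2 := p.2.factorial_pos
  field_simp

/-- The data for the construction: a skew-symmetric operator `A` on a dense domain, all of whose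
vectors are analytic with radius at least `r`. -/
structure IsAnalyticSkew (j : D →ₗ[ℂ] K) (A : D →ₗ[ℂ] D) (r : ℝ) : Prop where
  dense : DenseRange j
  skew : ∀ v w, inner ℂ (j (A v)) (j w) = -inner ℂ (j v) (j (A w))
  pos : 0 < r
  summable : ∀ v, Summable fun k : ℕ => r ^ k / k.factorial * ‖j ((A ^ k) v)‖

variable {j : D →ₗ[ℂ] K} {A : D →ₗ[ℂ] D} {r : ℝ}

namespace IsAnalyticSkew

theorem inner_pow (h : IsAnalyticSkew j A r) (k l : ℕ) (v w : D) :
    inner ℂ (j ((A ^ k) v)) (j ((A ^ l) w)) = (-1) ^ k * inner ℂ (j v) (j ((A ^ (k + l)) w)) := by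
  induction k generalizing l with
  | zero => simp
  | succ k ih =>
    rw [pow_succ' A k, Module.End.mul_apply, h.skew, ← Module.End.mul_apply, ← pow_succ', ih,
      pow_succ, add_right_comm, add_assoc k l 1]
    ring

theorem summable_norm (h : IsAnalyticSkew j A r) {t : ℝ} (ht : |t| ≤ r) (v : D) :
    Summable fun k : ℕ => ‖((t ^ k / k.factorial : ℝ) : ℂ) • j ((A ^ k) v)‖ := by
  refine (h.summable v).of_nonneg_of_le (fun _ => norm_nonneg _) fun k => ?_
  rw [norm_smul, Complex.norm_real, Real.norm_eq_abs, abs_div, abs_pow, Nat.abs_cast]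
  gcongr

variable [CompleteSpace K]

/-- The exponential series of `t A`. -/
def expSeries (h : IsAnalyticSkew j A r) (t : ℝ) (ht : |t| ≤ r) : D →ₗ[ℂ] K where
  toFun v := ∑' k : ℕ, ((t ^ k / k.factorial : ℝ) : ℂ) • j ((A ^ k) v)
  map_add' v w := by
    simp only [map_add, smul_add]
    exact (h.summable_norm ht v).of_norm.tsum_add (h.summable_norm ht w).of_norm
  map_smul' c v := by
    simp only [map_smul, smul_comm _ c, RingHom.id_apply]
    exact (h.summable_norm ht v).of_norm.tsum_const_smul c

theorem hasSum_expSeries (h : IsAnalyticSkew j A r) {t : ℝ} (ht : |t| ≤ r) (v : D) :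
    HasSum (fun k : ℕ => ((t ^ k / k.factorial : ℝ) : ℂ) • j ((A ^ k) v))
      (h.expSeries t ht v) :=
  (h.summable_norm ht v).of_norm.hasSum

/-- This is `(exp (s A))† exp (t A) = exp ((t - s) A)`. Skew-symmetry moves the powers of `A` to the
right with a sign `(-1) ^ k`, and absolute convergence allows summation along antidiagonals, where
the binomial theorem applies. Isometry, the adjoint and the local group law are special cases. -/
theorem inner_expSeries (h : IsAnalyticSkew j A r) {s t : ℝ} (hs : |s| ≤ r) (ht : |t| ≤ r)
    (hst : |t - s| ≤ r) (v w : D) :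
    inner ℂ (h.expSeries s hs v) (h.expSeries t ht w) =
      inner ℂ (j v) (h.expSeries (t - s) hst w) := by
  set a : ℕ → K := fun k => ((s ^ k / k.factorial : ℝ) : ℂ) • j ((A ^ k) v)
  set b : ℕ → K := fun k => ((t ^ k / k.factorial : ℝ) : ℂ) • j ((A ^ k) w)
  have ha := h.summable_norm hs v
  have hb := h.summable_norm ht w
  have hab : Summable fun p : ℕ × ℕ => inner ℂ (a p.1) (b p.2) := by
    refine Summable.of_norm_bounded
      (ha.mul_of_nonneg hb (fun _ => norm_nonneg _) fun _ => norm_nonneg _) fun p => ?_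
    exact norm_inner_le_norm _ _
  have h1 : HasSum (fun p : ℕ × ℕ => inner ℂ (a p.1) (b p.2))
      (inner ℂ (h.expSeries s hs v) (h.expSeries t ht w)) := by
    have h2 : ∀ x, HasSum (fun l => inner ℂ x (b l)) (inner ℂ x (h.expSeries t ht w)) := fun x =>
      (innerSL ℂ x).hasSum (h.hasSum_expSeries ht w)
    have h3 : HasSum (fun k => inner ℂ (a k) (h.expSeries t ht w))
        (inner ℂ (h.expSeries s hs v) (h.expSeries t ht w)) := by
      have := ((innerSL ℂ (h.expSeries t ht w)).hasSum (h.hasSum_expSeries hs v)).star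
      simpa only [innerSL_apply_apply, RCLike.star_def, inner_conj_symm] using this
    have h4 := hab.hasSum.prod_fiberwise fun k => h2 (a k)
    rw [h3.unique h4]
    exact hab.hasSum
  have h5 := (Finset.HasAntidiagonal.sigmaAntidiagonalEquivProd (A := ℕ)).hasSum_iff.2 h1
  have h6 := h5.sigma fun n => hasSum_fintype _
  have h7 : HasSum (fun n => inner ℂ (j v) ((((t - s) ^ n / n.factorial : ℝ) : ℂ) •
      j ((A ^ n) w))) (inner ℂ (j v) (h.expSeries (t - s) hst w)) :=
    (innerSL ℂ (j v)).hasSum (h.hasSum_expSeries hst w)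
  refine h6.unique (h7.congr_fun fun n => ?_)
  simp only [Function.comp_apply, Finset.HasAntidiagonal.sigmaAntidiagonalEquivProd_apply]
  rw [Finset.sum_coe_sort (Finset.HasAntidiagonal.antidiagonal n) fun p => inner ℂ (a p.1) (b p.2)]
  rw [inner_smul_right, sub_eq_neg_add, ← mul_pow_div_factorial_antidiagonal, Complex.ofReal_sum,
    Finset.sum_mul]
  refine Finset.sum_congr rfl fun p hp => ?_
  obtain rfl := Finset.HasAntidiagonal.mem_antidiagonal.1 hp
  simp only [a, b, inner_smul_left, inner_smul_right, h.inner_pow, Complex.conj_ofReal]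
  rw [neg_pow]
  push_cast
  ring

theorem expSeries_zero (h : IsAnalyticSkew j A r) (h0 : |(0 : ℝ)| ≤ r) (v : D) :
    h.expSeries 0 h0 v = j v := by
  refine (h.hasSum_expSeries h0 v).unique ?_
  convert hasSum_ite_eq 0 (j v) using 2 with k
  rcases k with _ | k <;> simp

theorem norm_expSeries (h : IsAnalyticSkew j A r) {t : ℝ} (ht : |t| ≤ r) (v : D) :
    ‖h.expSeries t ht v‖ = ‖j v‖ := by
  have h0 : |t - t| ≤ r := by simpa using h.pos.le
  have h1 := h.inner_expSeries ht ht h0 v v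
  have h2 : h.expSeries (t - t) h0 v = j v := by
    simp only [sub_self]; exact h.expSeries_zero _ v
  rw [h2, inner_self_eq_norm_sq_to_K, inner_self_eq_norm_sq_to_K] at h1
  have h3 : ‖h.expSeries t ht v‖ ^ 2 = ‖j v‖ ^ 2 := by exact_mod_cast h1
  exact (sq_eq_sq₀ (norm_nonneg _) (norm_nonneg _)).1 h3

open Classical in
/-- The local unitary group `exp (t A)` for `|t| ≤ r`. -/
def localExp (h : IsAnalyticSkew j A r) (t : ℝ) : K →L[ℂ] K :=
  if ht : |t| ≤ r then (h.expSeries t ht).extendOfNorm j else 0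

theorem localExp_apply (h : IsAnalyticSkew j A r) {t : ℝ} (ht : |t| ≤ r) (v : D) :
    h.localExp t (j v) = h.expSeries t ht v := by
  rw [localExp, dif_pos ht]
  exact LinearMap.extendOfNorm_eq h.dense ⟨1, fun x => by rw [one_mul, h.norm_expSeries]⟩ v

theorem inner_localExp (h : IsAnalyticSkew j A r) {s t : ℝ} (hs : |s| ≤ r) (ht : |t| ≤ r)
    (hst : |t - s| ≤ r) (x y : K) :
    inner ℂ (h.localExp s x) (h.localExp t y) = inner ℂ x (h.localExp (t - s) y) := by
  refine h.dense.induction_on₂ (p := fun x y =>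
    inner ℂ (h.localExp s x) (h.localExp t y) = inner ℂ x (h.localExp (t - s) y))
    (isClosed_eq (by fun_prop) (by fun_prop)) (fun v w => ?_) x y
  rw [h.localExp_apply hs, h.localExp_apply ht, h.localExp_apply hst, h.inner_expSeries]

theorem localExp_zero (h : IsAnalyticSkew j A r) : h.localExp 0 = 1 := by
  refine ContinuousLinearMap.ext fun x => ?_
  refine h.dense.induction_on (p := fun x => h.localExp 0 x = (1 : K →L[ℂ] K) x) x
    (isClosed_eq (by fun_prop) (by fun_prop)) fun v => ?_
  have h0 : |(0 : ℝ)| ≤ r := by simpa using h.pos.le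
  rw [h.localExp_apply h0, h.expSeries_zero]
  rfl

theorem adjoint_localExp (h : IsAnalyticSkew j A r) {t : ℝ} (ht : |t| ≤ r) :
    (h.localExp t).adjoint = h.localExp (-t) := by
  refine ((ContinuousLinearMap.eq_adjoint_iff _ _).2 fun x y => ?_).symm
  have h0 : |(0 : ℝ)| ≤ r := by simpa using h.pos.le
  have h1 := h.inner_localExp (s := -t) (t := 0) (by simpa using ht) h0 (by simpa using ht) x y
  simpa [h.localExp_zero] using h1

theorem localExp_add (h : IsAnalyticSkew j A r) {s t : ℝ} (hs : |s| ≤ r) (ht : |t| ≤ r)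
    (hst : |s + t| ≤ r) : h.localExp (s + t) = h.localExp s * h.localExp t := by
  refine ContinuousLinearMap.ext fun y => ext_inner_left ℂ fun x => ?_
  have h1 := h.inner_localExp (s := -s) (t := t) (by simpa using hs) ht
    (by rwa [sub_neg_eq_add, add_comm]) x y
  rw [sub_neg_eq_add, add_comm t] at h1
  rw [← h1, ← h.adjoint_localExp hs, ContinuousLinearMap.adjoint_inner_left]
  rfl

theorem localExp_nat_mul (h : IsAnalyticSkew j A r) {t : ℝ} (n : ℕ) (ht : n * |t| ≤ r) :
    h.localExp (n * t) = h.localExp t ^ n := by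
  induction n with
  | zero => simpa using h.localExp_zero
  | succ n ih =>
    push_cast at ht ⊢
    have h1 : n * |t| ≤ r := by nlinarith [abs_nonneg t]
    have h2 : |t| ≤ r := by nlinarith [abs_nonneg t, mul_nonneg n.cast_nonneg (abs_nonneg t)]
    rw [add_one_mul, h.localExp_add (by rwa [abs_mul, Nat.abs_cast]) h2, ih h1, pow_succ]
    rw [← add_one_mul, abs_mul]
    rwa [abs_of_nonneg (by positivity)]

/-- The unitary group generated by `A`. -/
def group (h : IsAnalyticSkew j A r) (t : ℝ) : K →L[ℂ] K :=
  h.localExp (t / (⌈|t| / r⌉₊ + 1 : ℕ)) ^ (⌈|t| / r⌉₊ + 1)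

/-- The definition cuts `t` into enough pieces of length at most `r`. Any other admissible number of
pieces gives the same operator, by passing to the common refinement. -/
theorem group_eq (h : IsAnalyticSkew j A r) {t : ℝ} {n : ℕ} (hn : 0 < n) (ht : |t| ≤ n * r) :
    h.group t = h.localExp (t / n) ^ n := by
  have key : ∀ m n : ℕ, 0 < m → 0 < n → |t| ≤ n * r →
      h.localExp (t / n) ^ n = h.localExp (t / (m * n)) ^ (m * n) := fun m n hm hn ht => by
    have hm' : (0 : ℝ) < m := by exact_mod_cast hm
    have hn' : (0 : ℝ) < n := by exact_mod_cast hn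
    rw [pow_mul, ← h.localExp_nat_mul (t := t / (m * n))]
    · congr 2
      field_simp
    · rw [abs_div, abs_of_pos (mul_pos hm' hn')]
      rw [show (m : ℝ) * (|t| / (m * n)) = |t| / n by field_simp, div_le_iff₀ hn']
      linarith
  have h1 : |t| ≤ (⌈|t| / r⌉₊ + 1 : ℕ) * r := by
    rw [← div_le_iff₀ h.pos]
    push_cast
    linarith [Nat.le_ceil (|t| / r)]
  rw [group, key n _ hn (Nat.succ_pos _) h1, key (⌈|t| / r⌉₊ + 1) n (Nat.succ_pos _) hn ht,
    mul_comm n, mul_comm (n : ℝ)]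

theorem group_eq_localExp (h : IsAnalyticSkew j A r) {t : ℝ} (ht : |t| ≤ r) :
    h.group t = h.localExp t := by
  simpa using h.group_eq one_pos (t := t) (by simpa using ht)

theorem group_add (h : IsAnalyticSkew j A r) (s t : ℝ) :
    h.group (s + t) = h.group s * h.group t := by
  -- One `n` serves for `s`, `t` and `s + t`, so the claim reduces to `(X * Y) ^ n = X ^ n * Y ^ n`
  -- for commuting short-time operators.
  obtain ⟨n, hn⟩ := exists_nat_gt ((|s| + |t|) / r)
  rw [div_lt_iff₀ h.pos] at hn
  have hn0 : 0 < n := by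
    rcases Nat.eq_zero_or_pos n with rfl | h0
    · simp only [Nat.cast_zero, zero_mul] at hn
      linarith [abs_nonneg s, abs_nonneg t]
    · exact h0
  have hn' : (0 : ℝ) < n := by exact_mod_cast hn0
  have hs : |s| ≤ n * r := by linarith [abs_nonneg t]
  have ht : |t| ≤ n * r := by linarith [abs_nonneg s]
  have hst : |s + t| ≤ n * r := (abs_add_le s t).trans hn.le
  have hd : ∀ {x : ℝ}, |x| ≤ n * r → |x / n| ≤ r := fun {x} hx => by
    rw [abs_div, Nat.abs_cast, div_le_iff₀ hn']; linarith
  have h1 : h.localExp (s / n + t / n) = h.localExp (s / n) * h.localExp (t / n) :=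
    h.localExp_add (hd hs) (hd ht) (by rw [← add_div]; exact hd hst)
  have h2 : h.localExp (t / n + s / n) = h.localExp (t / n) * h.localExp (s / n) :=
    h.localExp_add (hd ht) (hd hs) (by rw [← add_div, add_comm]; exact hd hst)
  rw [h.group_eq hn0 hs, h.group_eq hn0 ht, h.group_eq hn0 hst, add_div, h1]
  refine Commute.mul_pow ?_ n
  rw [Commute, SemiconjBy, ← h1, ← h2, add_comm]

theorem hasDerivAt_group (h : IsAnalyticSkew j A r) (v : D) :
    HasDerivAt (fun t => h.group t (j v)) (j (A v)) 0 := by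
  set C := ∑' k : ℕ, r ^ k / k.factorial * ‖j ((A ^ k) v)‖
  have hr := h.pos
  -- Taylor remainder of order two: for `|t| ≤ r` each term with index `k + 2` is at most `|t| ^ 2 /
  -- r ^ 2` times the corresponding term of the convergent series at `r`.
  have key : ∀ t : ℝ, |t| ≤ r →
      ‖h.group t (j v) - j v - t • j (A v)‖ ≤ C / r ^ 2 * |t| ^ 2 := fun t ht => by
    have h1 := h.hasSum_expSeries ht v
    rw [← h.localExp_apply ht, ← h.group_eq_localExp ht, ← hasSum_nat_add_iff' 2] at h1
    simp only [Finset.sum_range_succ, Finset.sum_range_zero, zero_add, pow_zero,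
      Nat.factorial_zero, Nat.cast_one, div_one, Complex.ofReal_one, one_smul, pow_one,
      Nat.factorial_one, Module.End.one_apply, ← sub_sub] at h1
    rw [Complex.coe_smul] at h1
    rw [← h1.tsum_eq]
    have h2 : Summable fun k : ℕ =>
        r ^ (k + 2) / (k + 2).factorial * ‖j ((A ^ (k + 2)) v)‖ :=
      (summable_nat_add_iff 2).2 (h.summable v)
    have h3 : ∑' k : ℕ, r ^ (k + 2) / (k + 2).factorial * ‖j ((A ^ (k + 2)) v)‖ ≤ C := by
      rw [show C = _ from ((h.summable v).sum_add_tsum_nat_add 2).symm]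
      exact le_add_of_nonneg_left (Finset.sum_nonneg fun _ _ => by positivity)
    calc _ ≤ ∑' k : ℕ, |t| ^ 2 / r ^ 2 *
          (r ^ (k + 2) / (k + 2).factorial * ‖j ((A ^ (k + 2)) v)‖) := by
          refine tsum_of_norm_bounded (h2.mul_left _).hasSum fun k => ?_
          rw [norm_smul, Complex.norm_real, Real.norm_eq_abs, abs_div, abs_pow, Nat.abs_cast,
            ← mul_assoc]
          refine mul_le_mul_of_nonneg_right ?_ (norm_nonneg _)
          rw [pow_add, pow_add, show |t| ^ 2 / r ^ 2 * (r ^ k * r ^ 2 / (k + 2).factorial) =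
            r ^ k * |t| ^ 2 / (k + 2).factorial by field_simp]
          gcongr
      _ = |t| ^ 2 / r ^ 2 * ∑' k : ℕ,
          r ^ (k + 2) / (k + 2).factorial * ‖j ((A ^ (k + 2)) v)‖ := tsum_mul_left
      _ ≤ |t| ^ 2 / r ^ 2 * C := by gcongr
      _ = _ := by ring
  rw [hasDerivAt_iff_isLittleO]
  have h0 : h.group 0 = 1 := by
    rw [h.group_eq_localExp (by simpa using hr.le), h.localExp_zero]
  have hO : (fun t => h.group t (j v) - h.group 0 (j v) - (t - 0) • j (A v)) =O[𝓝 0]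
      fun t : ℝ => t ^ 2 := by
    refine Asymptotics.IsBigO.of_bound (C / r ^ 2) ?_
    filter_upwards [Metric.ball_mem_nhds (0 : ℝ) hr] with t ht
    rw [h0, sub_zero, norm_pow, Real.norm_eq_abs t]
    refine key t ?_
    rw [Metric.mem_ball, dist_zero_right, Real.norm_eq_abs] at ht
    exact ht.le
  refine hO.trans_isLittleO ?_
  simpa using Asymptotics.isLittleO_pow_pow (𝕜 := ℝ) (m := 1) (n := 2) one_lt_two

theorem group_zero (h : IsAnalyticSkew j A r) : h.group 0 = 1 := by
  rw [h.group_eq_localExp (by simpa using h.pos.le), h.localExp_zero]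

theorem group_mem_unitary (h : IsAnalyticSkew j A r) (t : ℝ) :
    h.group t ∈ unitary (K →L[ℂ] K) := by
  refine Submonoid.pow_mem _ ?_ _
  set s := t / (⌈|t| / r⌉₊ + 1 : ℕ)
  have hs : |s| ≤ r := by
    have h0 : (0 : ℝ) < (⌈|t| / r⌉₊ + 1 : ℕ) := by positivity
    rw [abs_div, Nat.abs_cast, div_le_iff₀ h0, mul_comm, ← div_le_iff₀ h.pos]
    push_cast
    linarith [Nat.le_ceil (|t| / r)]
  have hs' : |-s| ≤ r := by rwa [abs_neg]
  rw [Unitary.mem_iff, ContinuousLinearMap.star_eq_adjoint, h.adjoint_localExp hs,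
    ← h.localExp_add hs' hs (by simpa using h.pos.le),
    ← h.localExp_add hs hs' (by simpa using h.pos.le)]
  simp [h.localExp_zero]

end IsAnalyticSkew

/-! ### General unitary groups and approximate orbits -/

variable [CompleteSpace K]

theorem norm_apply_of_mem_unitary {U : K →L[ℂ] K} (hU : U ∈ unitary (K →L[ℂ] K)) (x : K) :
    ‖U x‖ = ‖x‖ := by
  have h1 : U.adjoint (U x) = x :=
    congrArg (fun S : K →L[ℂ] K => S x) (Unitary.star_mul_self_of_mem hU)
  have h : inner ℂ (U x) (U x) = inner ℂ x x := by
    rw [← ContinuousLinearMap.adjoint_inner_right, h1]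
  rw [inner_self_eq_norm_sq_to_K, inner_self_eq_norm_sq_to_K] at h
  have h2 : ‖U x‖ ^ 2 = ‖x‖ ^ 2 := by exact_mod_cast h
  exact (sq_eq_sq₀ (norm_nonneg _) (norm_nonneg _)).1 h2

omit [CompleteSpace K] in
theorem hasDerivAt_of_map_add {U : ℝ → K →L[ℂ] K}
    (hadd : ∀ s t, U (s + t) = U s * U t) {x y : K} (h0 : HasDerivAt (fun t => U t x) y 0) (t : ℝ) :
    HasDerivAt (fun t => U t x) (U t y) t := by
  have h1 : HasDerivAt (fun s => U (s - t) x) y t := by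
    have h2 : HasDerivAt (fun t => U t x) y (t - t) := by rwa [sub_self]
    simpa using h2.comp_sub_const t t
  have h2 := ((U t).restrictScalars ℝ).hasFDerivAt.comp_hasDerivAt t h1
  refine h2.congr_of_eventuallyEq (Eventually.of_forall fun s => ?_)
  have h3 := hadd t (s - t)
  rw [add_sub_cancel] at h3
  simp [h3]

/-- A skew-symmetric operator with a dense domain of vectors that are analytic with a common
radius generates a unitary group. -/
theorem IsAnalyticSkew.isUnitaryGroupGeneratedBy (h : IsAnalyticSkew j A r) :
    IsUnitaryGroupGeneratedBy j A h.group where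
  mem_unitary := h.group_mem_unitary
  map_zero := h.group_zero
  map_add := h.group_add
  hasDerivAt := h.hasDerivAt_group
  continuous ψ := by
    -- Orbits of vectors in the domain are differentiable, hence continuous. Since the group is
    -- isometric, they approximate every other orbit uniformly in time.
    refine continuous_of_uniform_approx_of_continuous fun u hu => ?_
    obtain ⟨ε, hε, hεu⟩ := Metric.mem_uniformity_dist.1 hu
    obtain ⟨v, hv⟩ := h.dense.exists_dist_lt ψ hε
    refine ⟨fun t => h.group t (j v), ?_, fun t => hεu ?_⟩
    · exact continuous_iff_continuousAt.2 fun t =>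
        (hasDerivAt_of_map_add h.group_add (h.hasDerivAt_group v) t).continuousAt
    · rwa [dist_eq_norm, ← map_sub, norm_apply_of_mem_unitary (h.group_mem_unitary t),
        ← dist_eq_norm]

theorem isUnitaryGroupGeneratedBy_choose (h : ∃ U, IsUnitaryGroupGeneratedBy j A U) :
    IsUnitaryGroupGeneratedBy j A (unitaryExp j A) := by
  have : unitaryExp j A = h.choose := by
    ext t; rw [unitaryExp, dif_pos h]
  rw [this]
  exact h.choose_spec

/-- An approximate solution of `u' = A u` stays close to the orbit of the unitary group. -/
theorem IsUnitaryGroupGeneratedBy.norm_sub_le {U : ℝ → K →L[ℂ] K}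
    (hU : IsUnitaryGroupGeneratedBy j A U) {ι : Type*} (s : Finset ι) (d : ι → D)
    (c c' : ι → ℝ → ℝ) {T ε : ℝ} (hT : 0 ≤ T)
    (hc : ∀ i ∈ s, ∀ t ∈ Set.Icc 0 T, HasDerivAt (c i) (c' i t) t)
    (hε : ∀ t ∈ Set.Icc 0 T,
      ‖j (∑ i ∈ s, ((c' i t : ℂ) • d i - (c i t : ℂ) • A (d i)))‖ ≤ ε) :
    ‖j (∑ i ∈ s, (c i T : ℂ) • d i) - U T (j (∑ i ∈ s, (c i 0 : ℂ) • d i))‖ ≤ ε * T := by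
  -- With `u t = ∑ cᵢ(t) dᵢ`, the curve `F t = U (-t) (u t)` has derivative `U (-t) (u' - A u)`, of
  -- norm at most `ε`. The mean value inequality bounds `F T - F 0`, and applying the isometry `U T`
  -- gives `u T - U T (u 0)`.
  set F : ℝ → K := fun t => ∑ i ∈ s, c i t • U (-t) (j (d i))
  set F' : ℝ → K := fun t =>
    ∑ i ∈ s, (c i t • (-U (-t) (j (A (d i)))) + c' i t • U (-t) (j (d i)))
  have hF : ∀ t ∈ Set.Icc 0 T, HasDerivAt F (F' t) t := fun t ht => by
    refine HasDerivAt.fun_sum fun i hi => ?_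
    have h1 := hasDerivAt_of_map_add hU.map_add (hU.hasDerivAt (d i)) (-t)
    have h2 := h1.scomp t (hasDerivAt_neg t)
    rw [neg_one_smul] at h2
    exact (hc i hi t ht).smul h2
  have hF' : ∀ t ∈ Set.Icc 0 T, ‖F' t‖ ≤ ε := fun t ht => by
    have h1 : F' t = U (-t) (j (∑ i ∈ s, ((c' i t : ℂ) • d i - (c i t : ℂ) • A (d i)))) := by
      simp only [F', map_sum, map_sub, map_smul]
      simp only [Complex.coe_smul]
      exact Finset.sum_congr rfl fun i _ => by rw [smul_neg]; abel
    rw [h1, norm_apply_of_mem_unitary (hU.mem_unitary _)]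
    exact hε t ht
  have hmv := (convex_Icc (0 : ℝ) T).norm_image_sub_le_of_norm_hasDerivWithin_le
    (fun t ht => (hF t ht).hasDerivWithinAt) hF' ⟨le_rfl, hT⟩ ⟨hT, le_rfl⟩
  rw [sub_zero, Real.norm_of_nonneg hT] at hmv
  refine le_trans (le_of_eq ?_) hmv
  rw [← norm_apply_of_mem_unitary (hU.mem_unitary T) (F T - F 0)]
  congr 1
  have hinv : ∀ x, U T (U (-T) x) = x := fun x => by
    rw [← mul_apply_eq_comp, ← hU.map_add, add_neg_cancel, hU.map_zero]; rfl
  have hsm : ∀ (a : ℝ) (x : K), U T (a • x) = a • U T x := (U T).map_smul_of_tower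
  rw [map_sub]
  simp only [F, map_sum, neg_zero, hU.map_zero, map_smul, one_apply_eq_self]
  simp only [Complex.coe_smul, hsm, hinv]

end Group

/-! ### The two modes -/

omit [CompleteSpace H] in
theorem tensorRight_apply (φ ψ : H) : tensorRight φ ψ = ((ψ ⊗ₜ[ℂ] φ : H ⊗[ℂ] H) : TwoMode H) := rfl

omit [CompleteSpace H] in
theorem inner_tensorRight (φ φ' ψ ψ' : H) :
    inner ℂ (tensorRight φ ψ) (tensorRight φ' ψ') = inner ℂ ψ ψ' * inner ℂ φ φ' := by
  rw [tensorRight_apply, tensorRight_apply, UniformSpace.Completion.inner_coe,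
    TensorProduct.inner_tmul]

omit [CompleteSpace H] in
theorem norm_tensorRight (φ ψ : H) : ‖tensorRight φ ψ‖ = ‖ψ‖ * ‖φ‖ := by
  rw [tensorRight_apply, UniformSpace.Completion.norm_coe, TensorProduct.norm_tmul]

theorem adjoint_tensorRight_apply (φ φ' ψ : H) :
    (tensorRight φ).adjoint (tensorRight φ' ψ) = (inner ℂ φ φ' : ℂ) • ψ := by
  refine ext_inner_left ℂ fun x => ?_
  rw [ContinuousLinearMap.adjoint_inner_right, inner_tensorRight, inner_smul_right, mul_comm]

omit [CompleteSpace H] in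
theorem twoMode_induction {p : TwoMode H → Prop} (x : TwoMode H) (hc : IsClosed {x | p x})
    (h0 : p 0) (ht : ∀ φ ψ, p (tensorRight φ ψ)) (ha : ∀ x y, p x → p y → p (x + y)) : p x := by
  refine UniformSpace.Completion.induction_on x hc fun a => ?_
  induction a using TensorProduct.induction_on with
  | zero => rwa [UniformSpace.Completion.coe_zero]
  | tmul ψ φ => exact ht φ ψ
  | add a b h1 h2 => rw [UniformSpace.Completion.coe_add]; exact ha _ _ h1 h2

/-- `ρ ⊗ |φ⟩⟨φ|` in terms of the map `ψ ↦ ψ ⊗ φ`. -/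
theorem tensorOp_rankOne (ρ : H →L[ℂ] H) (φ : H) :
    tensorOp ρ (InnerProductSpace.rankOne ℂ φ φ) =
      tensorRight φ ∘L ρ ∘L (tensorRight φ).adjoint := by
  refine ContinuousLinearMap.ext fun x => twoMode_induction
    (p := fun x => tensorOp ρ (InnerProductSpace.rankOne ℂ φ φ) x =
      (tensorRight φ ∘L ρ ∘L (tensorRight φ).adjoint) x) x
    (isClosed_eq (by fun_prop) (by fun_prop)) (by simp) (fun φ' ψ => ?_)
    fun x y hx hy => by simp only [map_add, hx, hy]
  rw [ContinuousLinearMap.comp_apply, ContinuousLinearMap.comp_apply, adjoint_tensorRight_apply,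
    tensorOp, tensorRight_apply, tensorRight_apply, ContinuousLinearMap.completion_apply_coe,
    TensorProduct.mapL_tmul, InnerProductSpace.rankOne_apply, map_smul, TensorProduct.tmul_smul,
    TensorProduct.smul_tmul']

omit [CompleteSpace H] in
theorem toMode_single (fock : HilbertBasis ℕ ℂ H) (n : ℕ) (c : ℂ) :
    toMode fock (Finsupp.single n c) = c • fock n := by
  simp [toMode]

omit [CompleteSpace H] in
theorem toTwoMode_single (fock : HilbertBasis ℕ ℂ H) (p : ℕ × ℕ) (c : ℂ) :
    toTwoMode fock (Finsupp.single p c) = c • tensorRight (fock p.2) (fock p.1) := by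
  simp [toTwoMode]

omit [CompleteSpace H] in
theorem inner_fock (fock : HilbertBasis ℕ ℂ H) (n m : ℕ) :
    (inner ℂ (fock n) (fock m) : ℂ) = if n = m then 1 else 0 :=
  orthonormal_iff_ite.1 fock.orthonormal n m

omit [CompleteSpace H] in
theorem inner_toTwoMode_single (fock : HilbertBasis ℕ ℂ H) (p q : ℕ × ℕ) (c d : ℂ) :
    inner ℂ (toTwoMode fock (Finsupp.single p c)) (toTwoMode fock (Finsupp.single q d)) =
      if p = q then star c * d else 0 := by
  rw [toTwoMode_single, toTwoMode_single, inner_smul_left, inner_smul_right, inner_tensorRight,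
    inner_fock, inner_fock]
  by_cases h1 : p.1 = q.1 <;> by_cases h2 : p.2 = q.2 <;> simp [Prod.ext_iff, h1, h2]

omit [CompleteSpace H] in
theorem norm_toTwoMode_single (fock : HilbertBasis ℕ ℂ H) (p : ℕ × ℕ) (c : ℂ) :
    ‖toTwoMode fock (Finsupp.single p c)‖ = ‖c‖ := by
  rw [toTwoMode_single, norm_smul, norm_tensorRight, fock.orthonormal.1, fock.orthonormal.1]
  simp

omit [CompleteSpace H] in
theorem denseRange_toMode (fock : HilbertBasis ℕ ℂ H) : DenseRange (toMode fock) := by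
  have h := fock.dense_span
  rw [← Finsupp.range_linearCombination] at h
  rw [DenseRange, dense_iff_closure_eq]
  have h1 := congrArg (fun S : Submodule ℂ H => (S : Set H)) h
  simpa [Submodule.topologicalClosure_coe] using! h1

omit [CompleteSpace H] in
-- Density is proved one factor at a time, since `ψ ⊗ φ` is continuous and linear in each: first
-- general `ψ` with a Fock state in the environment, then general `φ`.
theorem denseRange_toTwoMode (fock : HilbertBasis ℕ ℂ H) : DenseRange (toTwoMode fock) := by
  set M : Submodule ℂ (TwoMode H) := (toTwoMode fock).range.topologicalClosure
  have hM : IsClosed (M : Set (TwoMode H)) := Submodule.isClosed_topologicalClosure _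
  have hflip : ∀ φ ψ : H, tensorRight φ ψ =
      (UniformSpace.Completion.toComplL ∘L TensorProduct.mkL ℂ H H ψ) φ := fun _ _ => rfl
  have h1 : ∀ n m, tensorRight (fock m) (fock n) ∈ M := fun n m =>
    Submodule.le_topologicalClosure _ ⟨Finsupp.single (n, m) 1, by simp [toTwoMode_single]⟩
  have h2 : ∀ (m : ℕ) (ψ : H), tensorRight (fock m) ψ ∈ M := fun m ψ => by
    refine (denseRange_toMode fock).induction_on (p := fun ψ => tensorRight (fock m) ψ ∈ M) ψ
      (hM.preimage (tensorRight (fock m)).continuous) fun v => ?_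
    induction v using Finsupp.induction_linear with
    | zero => simp
    | add v w hv hw => simpa using M.add_mem hv hw
    | single n c => simpa [toMode_single] using M.smul_mem c (h1 n m)
  have h3 : ∀ φ ψ : H, tensorRight φ ψ ∈ M := fun φ ψ => by
    rw [hflip]
    refine (denseRange_toMode fock).induction_on (p := fun φ =>
      (UniformSpace.Completion.toComplL ∘L TensorProduct.mkL ℂ H H ψ) φ ∈ M) φ
      (hM.preimage (ContinuousLinearMap.continuous _)) fun v => ?_
    induction v using Finsupp.induction_linear with
    | zero => rw [map_zero, map_zero]; exact M.zero_mem
    | add v w hv hw => rw [map_add, map_add]; exact M.add_mem hv hw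
    | single n c =>
      rw [toMode_single, map_smul, ← hflip]
      exact M.smul_mem c (h2 n ψ)
  intro x
  exact twoMode_induction (p := fun x => x ∈ M) x hM M.zero_mem h3 fun _ _ => M.add_mem

/-! ### Ladder operators -/

section Ladder

theorem createS_single (p : ℕ × ℕ) (c : ℂ) : createS (Finsupp.single p c) =
    Finsupp.single (p.1 + 1, p.2) (c * (√((p.1 : ℝ) + 1) : ℝ)) := by
  simp [createS]

theorem annihilateS_single (p : ℕ × ℕ) (c : ℂ) : annihilateS (Finsupp.single p c) =
    Finsupp.single (p.1 - 1, p.2) (c * (√(p.1 : ℝ) : ℝ)) := by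
  simp [annihilateS]

theorem createE_single (p : ℕ × ℕ) (c : ℂ) : createE (Finsupp.single p c) =
    Finsupp.single (p.1, p.2 + 1) (c * (√((p.2 : ℝ) + 1) : ℝ)) := by
  simp [createE]

theorem annihilateE_single (p : ℕ × ℕ) (c : ℂ) : annihilateE (Finsupp.single p c) =
    Finsupp.single (p.1, p.2 - 1) (c * (√(p.2 : ℝ) : ℝ)) := by
  simp [annihilateE]

theorem beamSplitterGen_single (p : ℕ × ℕ) (c : ℂ) : beamSplitterGen (Finsupp.single p c) =
    Finsupp.single (p.1 + 1, p.2 - 1) (c * (√((p.1 : ℝ) + 1) * √(p.2 : ℝ) : ℝ)) -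
      Finsupp.single (p.1 - 1, p.2 + 1) (c * (√(p.1 : ℝ) * √((p.2 : ℝ) + 1) : ℝ)) := by
  simp only [beamSplitterGen, LinearMap.sub_apply, Module.End.mul_apply, createS_single,
    annihilateE_single, annihilateS_single, createE_single]
  push_cast
  congr 2 <;> ring

theorem squeezingGen_single (p : ℕ × ℕ) (c : ℂ) : squeezingGen (Finsupp.single p c) =
    Finsupp.single (p.1 + 1, p.2 + 1) (c * (√((p.1 : ℝ) + 1) * √((p.2 : ℝ) + 1) : ℝ)) -
      Finsupp.single (p.1 - 1, p.2 - 1) (c * (√(p.1 : ℝ) * √(p.2 : ℝ) : ℝ)) := by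
  simp only [squeezingGen, LinearMap.sub_apply, Module.End.mul_apply, createS_single,
    annihilateE_single, annihilateS_single, createE_single]
  push_cast
  congr 2 <;> ring

variable (fock : HilbertBasis ℕ ℂ H)

/-- `X` and `Y` are adjoint to each other on the finite-particle vectors of the two modes. -/
def IsFormalAdjoint (X Y : (ℕ × ℕ →₀ ℂ) →ₗ[ℂ] (ℕ × ℕ →₀ ℂ)) : Prop :=
  ∀ v w, inner ℂ (toTwoMode fock (X v)) (toTwoMode fock w) =
    inner ℂ (toTwoMode fock v) (toTwoMode fock (Y w))

variable {fock} {X Y X' Y' : (ℕ × ℕ →₀ ℂ) →ₗ[ℂ] (ℕ × ℕ →₀ ℂ)}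

omit [CompleteSpace H] in
theorem IsFormalAdjoint.symm (h : IsFormalAdjoint fock X Y) : IsFormalAdjoint fock Y X :=
  fun v w => by
    rw [← inner_conj_symm, ← h, inner_conj_symm]

omit [CompleteSpace H] in
theorem IsFormalAdjoint.mul (h : IsFormalAdjoint fock X Y) (h' : IsFormalAdjoint fock X' Y') :
    IsFormalAdjoint fock (X * X') (Y' * Y) := fun v w => by
  rw [Module.End.mul_apply, h, h', Module.End.mul_apply]

omit [CompleteSpace H] in
theorem IsFormalAdjoint.of_single
    (h : ∀ p q, inner ℂ (toTwoMode fock (X (Finsupp.single p 1)))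
      (toTwoMode fock (Finsupp.single q 1)) =
      inner ℂ (toTwoMode fock (Finsupp.single p 1)) (toTwoMode fock (Y (Finsupp.single q 1)))) :
    IsFormalAdjoint fock X Y := fun v w => by
  have hs : ∀ (p : ℕ × ℕ) (c : ℂ), Finsupp.single p c = c • Finsupp.single p 1 := fun p c => by
    simp
  induction v using Finsupp.induction_linear with
  | zero => simp
  | add v v' h1 h2 => simp only [map_add, inner_add_left, h1, h2]
  | single p c =>
    induction w using Finsupp.induction_linear with
    | zero => simp
    | add w w' h1 h2 => simp only [map_add, inner_add_right, h1, h2]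
    | single q d =>
      rw [hs p c, hs q d]
      simp only [map_smul, inner_smul_left, inner_smul_right, h]

omit [CompleteSpace H] in
variable (fock) in
theorem isFormalAdjoint_createS : IsFormalAdjoint fock createS annihilateS := by
  refine .of_single fun p q => ?_
  rw [createS_single, annihilateS_single, inner_toTwoMode_single, inner_toTwoMode_single]
  obtain ⟨p1, p2⟩ := p
  obtain ⟨q1 | q1, q2⟩ := q
  · simp
  · by_cases h : p1 = q1 <;> by_cases h' : p2 = q2 <;> simp [h, h']

omit [CompleteSpace H] in
variable (fock) in
theorem isFormalAdjoint_createE : IsFormalAdjoint fock createE annihilateE := by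
  refine .of_single fun p q => ?_
  rw [createE_single, annihilateE_single, inner_toTwoMode_single, inner_toTwoMode_single]
  obtain ⟨p1, p2⟩ := p
  obtain ⟨q1, q2 | q2⟩ := q
  · simp
  · by_cases h : p1 = q1 <;> by_cases h' : p2 = q2 <;> simp [h, h']

omit [CompleteSpace H] in
theorem IsFormalAdjoint.skew_sub (h : IsFormalAdjoint fock X Y) (v w : ℕ × ℕ →₀ ℂ) :
    inner ℂ (toTwoMode fock ((X - Y) v)) (toTwoMode fock w) =
      -inner ℂ (toTwoMode fock v) (toTwoMode fock ((X - Y) w)) := by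
  simp only [LinearMap.sub_apply, map_sub, inner_sub_left, inner_sub_right, h v w, h.symm v w]
  ring

/-- Formal adjoints reverse products, so the adjoint of `a† b` comes out as `b† a`, whereas the
generator is written with `a b†`. -/
theorem commute_createE_annihilateS : createE * annihilateS = annihilateS * createE := by
  refine Finsupp.lhom_ext fun p c => ?_
  simp only [Module.End.mul_apply, createE_single, annihilateS_single]
  congr 1
  ring

theorem commute_annihilateE_annihilateS :
    annihilateE * annihilateS = annihilateS * annihilateE := by
  refine Finsupp.lhom_ext fun p c => ?_
  simp only [Module.End.mul_apply, annihilateE_single, annihilateS_single]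
  congr 1
  ring

/-- The operator maps `|p⟩` to a combination of two basis vectors, raising the total photon number
by at most two, with coefficients of linear growth. -/
def HasLinearGrowth (A : (ℕ × ℕ →₀ ℂ) →ₗ[ℂ] (ℕ × ℕ →₀ ℂ)) : Prop :=
  ∀ p : ℕ × ℕ, ∃ (q q' : ℕ × ℕ) (α β : ℂ), q.1 + q.2 ≤ p.1 + p.2 + 2 ∧
    q'.1 + q'.2 ≤ p.1 + p.2 + 2 ∧ ‖α‖ + ‖β‖ ≤ (p.1 + p.2 : ℕ) + 2 ∧
    A (Finsupp.single p 1) = α • Finsupp.single q 1 + β • Finsupp.single q' 1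

omit [CompleteSpace H] in
variable (fock) in
-- Each application of `A` costs a factor of at most (photon bound) `+ 2` and raises the photon
-- bound by `2`; hence the product of `N + 2`, `N + 4`, and so on.
theorem HasLinearGrowth.norm_pow_le {A : (ℕ × ℕ →₀ ℂ) →ₗ[ℂ] (ℕ × ℕ →₀ ℂ)}
    (hA : HasLinearGrowth A) (k N : ℕ) (p : ℕ × ℕ) (hp : p.1 + p.2 ≤ N) :
    ‖toTwoMode fock ((A ^ k) (Finsupp.single p 1))‖ ≤
      ∏ i ∈ Finset.range k, ((N : ℝ) + 2 * (i + 1)) := by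
  induction k generalizing N p with
  | zero => simp [norm_toTwoMode_single]
  | succ k ih =>
    obtain ⟨q, q', α, β, hq, hq', hαβ, h⟩ := hA p
    rw [pow_succ, Module.End.mul_apply, h, map_add, map_add, map_smul, map_smul, map_smul, map_smul]
    have h1 := ih (N + 2) q (by omega)
    have h2 := ih (N + 2) q' (by omega)
    have hN : ((p.1 + p.2 : ℕ) : ℝ) ≤ N := by exact_mod_cast hp
    set B := ∏ i ∈ Finset.range k, (((N + 2 : ℕ) : ℝ) + 2 * (i + 1))
    have hB : 0 ≤ B := (norm_nonneg _).trans h1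
    calc _ ≤ ‖α‖ * B + ‖β‖ * B := by
          refine (norm_add_le _ _).trans ?_
          rw [norm_smul, norm_smul]
          gcongr
      _ = (‖α‖ + ‖β‖) * B := by ring
      _ ≤ (N + 2) * B := mul_le_mul_of_nonneg_right (by linarith) hB
      _ = _ := by
          rw [Finset.prod_range_succ']
          push_cast
          rw [mul_comm]
          congr 1
          · refine Finset.prod_congr rfl fun i _ => ?_
            push_cast; ring
          · ring

/-- Each factor is at most `2 (N + i + 1)`, and the product of the `N + i + 1` is `(k + N)! / N!`.
-/
theorem prod_le_two_pow_mul_factorial (k N : ℕ) :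
    ∏ i ∈ Finset.range k, ((N : ℝ) + 2 * (i + 1)) ≤
      2 ^ k * ((k + N).choose N * k.factorial) := by
  induction k with
  | zero => simp
  | succ k ih =>
    have h1 : ((k + 1 + N).choose N : ℝ) * (k + 1).factorial =
        (k + N + 1) * ((k + N).choose N * k.factorial) := by
      have h2 := Nat.add_choose_mul_factorial_mul_factorial (k + 1) N
      have h3 := Nat.add_choose_mul_factorial_mul_factorial k N
      rw [show k + 1 + N = (k + N) + 1 by ring, Nat.factorial_succ (k + N), ← h3] at h2
      have hN : (N.factorial : ℝ) ≠ 0 := by exact_mod_cast N.factorial_ne_zero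
      rw [show k + 1 + N = (k + N) + 1 by ring]
      have h4 : (((k + N + 1).choose N * (k + 1).factorial * N.factorial : ℕ) : ℝ) =
        (((k + N + 1) * ((k + N).choose N * k.factorial * N.factorial) : ℕ) : ℝ) := by
        exact_mod_cast h2
      push_cast at h4
      refine mul_right_cancel₀ hN ?_
      linarith
    rw [Finset.prod_range_succ, h1, pow_succ]
    calc _ ≤ 2 ^ k * ((k + N).choose N * k.factorial) * (2 * (k + N + 1) : ℝ) := by
          gcongr
          have : (0 : ℝ) ≤ N := N.cast_nonneg
          linarith
      _ = _ := by ring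

omit [CompleteSpace H] in
variable (fock) in
theorem HasLinearGrowth.isAnalyticSkew {A : (ℕ × ℕ →₀ ℂ) →ₗ[ℂ] (ℕ × ℕ →₀ ℂ)}
    (hA : HasLinearGrowth A)
    (hskew : ∀ v w, inner ℂ (toTwoMode fock (A v)) (toTwoMode fock w) =
      -inner ℂ (toTwoMode fock v) (toTwoMode fock (A w))) :
    IsAnalyticSkew (toTwoMode fock) A (1 / 4) where
  dense := denseRange_toTwoMode fock
  skew := hskew
  pos := by norm_num
  summable v := by
    induction v using Finsupp.induction_linear with
    | zero => simp
    | add v w hv hw =>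
      refine (hv.add hw).of_nonneg_of_le (fun _ => by positivity) fun k => ?_
      rw [map_add, map_add, ← mul_add]
      gcongr
      exact norm_add_le _ _
    -- The `k!` in the bound cancels the one in the exponential series, leaving a polynomial in `k`
    -- times `(2 r) ^ k`. The value `r = 1 / 4` works for every basis vector at once.
    | single p c =>
      have h1 : Summable fun k : ℕ => ((k + (p.1 + p.2)).choose (p.1 + p.2) : ℝ) * (1 / 2) ^ k :=
        summable_choose_mul_geometric_of_norm_lt_one _ (by norm_num)
      refine (h1.mul_left ‖c‖).of_nonneg_of_le (fun _ => by positivity) fun k => ?_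
      have h2 := (hA.norm_pow_le fock k _ p le_rfl).trans (prod_le_two_pow_mul_factorial _ _)
      have h3 : Finsupp.single p c = c • Finsupp.single p (1 : ℂ) := by simp
      have hk : (k.factorial : ℝ) ≠ 0 := by exact_mod_cast k.factorial_ne_zero
      rw [h3, map_smul, map_smul, norm_smul]
      calc _ ≤ (1 / 4) ^ k / k.factorial * (‖c‖ * (2 ^ k *
            ((k + (p.1 + p.2)).choose (p.1 + p.2) * k.factorial))) := by gcongr
        _ = _ := by
          rw [show (1 / 2 : ℝ) ^ k = (1 / 4) ^ k * 2 ^ k by rw [← mul_pow]; norm_num]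
          field_simp

theorem sqrt_mul_sqrt_le {x y : ℝ} (hx : 0 ≤ x) (hy : 0 ≤ y) : √x * √y ≤ (x + y) / 2 := by
  nlinarith [sq_nonneg (√x - √y), Real.sq_sqrt hx, Real.sq_sqrt hy]

theorem hasLinearGrowth_beamSplitterGen : HasLinearGrowth beamSplitterGen := fun p => by
  refine ⟨(p.1 + 1, p.2 - 1), (p.1 - 1, p.2 + 1), (√((p.1 : ℝ) + 1) * √(p.2 : ℝ) : ℝ),
    (-(√(p.1 : ℝ) * √((p.2 : ℝ) + 1)) : ℝ), by dsimp only; omega, by dsimp only; omega, ?_, ?_⟩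
  · rw [Complex.norm_real, Complex.norm_real, norm_neg, Real.norm_of_nonneg (by positivity),
      Real.norm_of_nonneg (by positivity)]
    have h1 := sqrt_mul_sqrt_le (x := (p.1 : ℝ) + 1) (y := p.2) (by positivity) (by positivity)
    have h2 := sqrt_mul_sqrt_le (x := (p.1 : ℝ)) (y := (p.2 : ℝ) + 1) (by positivity)
      (by positivity)
    push_cast
    linarith
  · rw [beamSplitterGen_single, Complex.ofReal_neg, neg_smul, ← sub_eq_add_neg]
    simp

theorem hasLinearGrowth_squeezingGen : HasLinearGrowth squeezingGen := fun p => by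
  refine ⟨(p.1 + 1, p.2 + 1), (p.1 - 1, p.2 - 1), (√((p.1 : ℝ) + 1) * √((p.2 : ℝ) + 1) : ℝ),
    (-(√(p.1 : ℝ) * √(p.2 : ℝ)) : ℝ), by dsimp only; omega, by dsimp only; omega, ?_, ?_⟩
  · rw [Complex.norm_real, Complex.norm_real, norm_neg, Real.norm_of_nonneg (by positivity),
      Real.norm_of_nonneg (by positivity)]
    have h1 := sqrt_mul_sqrt_le (x := (p.1 : ℝ) + 1) (y := (p.2 : ℝ) + 1) (by positivity)
      (by positivity)
    have h2 := sqrt_mul_sqrt_le (x := (p.1 : ℝ)) (y := p.2) (by positivity) (by positivity)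
    push_cast
    linarith
  · rw [squeezingGen_single, Complex.ofReal_neg, neg_smul, ← sub_eq_add_neg]
    simp

variable (fock)

omit [CompleteSpace H] in
theorem isUnitaryGroupGeneratedBy_beamSplitterGen :
    IsUnitaryGroupGeneratedBy (toTwoMode fock) beamSplitterGen
      (unitaryExp (toTwoMode fock) beamSplitterGen) := by
  refine isUnitaryGroupGeneratedBy_choose
    ⟨_, (hasLinearGrowth_beamSplitterGen.isAnalyticSkew fock
      fun v w => ?_).isUnitaryGroupGeneratedBy⟩
  rw [beamSplitterGen, ← commute_createE_annihilateS]
  exact ((isFormalAdjoint_createS fock).mul (isFormalAdjoint_createE fock).symm).skew_sub v w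

omit [CompleteSpace H] in
theorem isUnitaryGroupGeneratedBy_squeezingGen :
    IsUnitaryGroupGeneratedBy (toTwoMode fock) squeezingGen
      (unitaryExp (toTwoMode fock) squeezingGen) := by
  refine isUnitaryGroupGeneratedBy_choose
    ⟨_, (hasLinearGrowth_squeezingGen.isAnalyticSkew fock
      fun v w => ?_).isUnitaryGroupGeneratedBy⟩
  rw [squeezingGen, ← commute_annihilateE_annihilateS]
  exact ((isFormalAdjoint_createS fock).mul (isFormalAdjoint_createE fock)).skew_sub v w

end Ladder

/-! ### Channels with a vacuum environment -/

variable (fock : HilbertBasis ℕ ℂ H)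

omit [CompleteSpace H] in
theorem thermalState_zero : thermalState fock 0 = ketBra fock 0 0 := by
  rw [thermalState, tsum_eq_single 0 fun n hn => by simp [hn]]
  simp

/-- The operators `⟨j|_E U |0⟩_E`. -/
def vacuumKraus (U : TwoMode H →L[ℂ] TwoMode H) (j : ℕ) : H →L[ℂ] H :=
  (tensorRight (fock j)).adjoint ∘L U ∘L tensorRight (fock 0)

theorem partialTrace_vacuum (U : TwoMode H →L[ℂ] TwoMode H) (ρ : H →L[ℂ] H) :
    partialTrace fock (U ∘L tensorOp ρ (thermalState fock 0) ∘L U.adjoint) =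
      ∑' j, vacuumKraus fock U j ∘L ρ ∘L (vacuumKraus fock U j).adjoint := by
  rw [partialTrace, thermalState_zero, ketBra, tensorOp_rankOne]
  refine tsum_congr fun j => ?_
  simp only [vacuumKraus, ContinuousLinearMap.adjoint_comp, ContinuousLinearMap.adjoint_adjoint,
    ContinuousLinearMap.comp_assoc]

/-- Bessel's inequality for the mutually orthogonal isometric embeddings `ψ ↦ ψ ⊗ |j⟩`: `y` is the
projection of `x` to the span of their ranges, and `‖x - y‖ ^ 2 = ‖x‖ ^ 2 - ‖y‖ ^ 2`. -/
theorem sum_norm_adjoint_tensorRight_sq_le (s : Finset ℕ) (x : TwoMode H) :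
    ∑ j ∈ s, ‖(tensorRight (fock j)).adjoint x‖ ^ 2 ≤ ‖x‖ ^ 2 := by
  set R : ℕ → H →L[ℂ] TwoMode H := fun j => tensorRight (fock j)
  set y := ∑ j ∈ s, R j ((R j).adjoint x)
  have h1 : RCLike.re (inner ℂ x y) = ∑ j ∈ s, ‖(R j).adjoint x‖ ^ 2 := by
    simp only [y, inner_sum, map_sum]
    refine Finset.sum_congr rfl fun j _ => ?_
    rw [← ContinuousLinearMap.adjoint_inner_left, inner_self_eq_norm_sq]
  have h2 : ‖y‖ ^ 2 = ∑ j ∈ s, ‖(R j).adjoint x‖ ^ 2 := by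
    rw [← inner_self_eq_norm_sq (𝕜 := ℂ) y]
    simp only [y, inner_sum, sum_inner, map_sum]
    refine Finset.sum_congr rfl fun j hj => ?_
    rw [Finset.sum_eq_single j]
    · rw [inner_tensorRight, inner_fock, if_pos rfl, mul_one, inner_self_eq_norm_sq]
    · intro i _ hij
      rw [inner_tensorRight, inner_fock, if_neg hij, mul_zero, map_zero]
    · exact fun h => absurd hj h
  have h3 := @norm_sub_sq ℂ (TwoMode H) _ _ _ x y
  rw [h1, h2] at h3
  nlinarith [sq_nonneg ‖x - y‖]

theorem isContractiveFamily_vacuumKraus {U : TwoMode H →L[ℂ] TwoMode H}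
    (hU : U ∈ unitary (TwoMode H →L[ℂ] TwoMode H)) : IsContractiveFamily (vacuumKraus fock U) :=
  fun s x => by
    have h := sum_norm_adjoint_tensorRight_sq_le fock s (U (tensorRight (fock 0) x))
    rwa [norm_apply_of_mem_unitary hU, norm_tensorRight, fock.orthonormal.1, mul_one] at h

/-! ### The orbits of the vacuum environment under the two unitary groups -/

/-- This is the defect `u' - A u` of a trial solution along a chain `d 0, d 1, …` on which `A` moves
one step up and one step down. In the interior `G` and `F` cancel what `A` brings from the two
neighbours; only the contributions across the cut at `N` survive. -/
theorem sum_range_telescope {D : Type*} [AddCommGroup D] [Module ℂ D] (A : D →ₗ[ℂ] D) (d : ℕ → D)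
    (F G c : ℕ → ℝ) (N : ℕ) (hF : F 0 = 0) (h0 : (c 0 : ℂ) • A (d 0) = -((F 1 : ℂ) • d 1))
    (hS : ∀ m < N, (c (m + 1) : ℂ) • A (d (m + 1)) =
      (G m : ℂ) • d m - (F (m + 2) : ℂ) • d (m + 2)) :
    ∑ m ∈ Finset.range (N + 1), (((G m - F m : ℝ) : ℂ) • d m - (c m : ℂ) • A (d m)) =
      (G N : ℂ) • d N + (F (N + 1) : ℂ) • d (N + 1) := by
  induction N with
  | zero => rw [zero_add, Finset.sum_range_one, h0, hF, sub_zero, sub_neg_eq_add]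
  | succ N ih =>
    rw [Finset.sum_range_succ, ih fun m hm => hS m (hm.trans N.lt_succ_self), hS N N.lt_succ_self]
    push_cast
    module

/-- Turns a recursion `a * x = b * y` between binomial coefficients into the recursion between
amplitudes, where the coefficients and the ladder factors occur under square roots. -/
theorem sqrt_mul_sqrt_mul_sqrt {a b x y : ℝ} (ha : 0 ≤ a) (hb : 0 ≤ b) (hy : 0 ≤ y)
    (h : a * x = b * y) : √a * (√x * √y) = √b * y := by
  rw [← mul_assoc, ← Real.sqrt_mul ha, h, Real.sqrt_mul hb, mul_assoc, Real.mul_self_sqrt hy]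

theorem adjoint_tensorRight_sum (fock : HilbertBasis ℕ ℂ H) (s : Finset ℕ) (f : ℕ → ℕ)
    (c : ℕ → ℝ) (k : ℕ) : (tensorRight (fock k)).adjoint
      (toTwoMode fock (∑ m ∈ s, (c m : ℂ) • Finsupp.single (f m, m) 1)) =
      if k ∈ s then (c k : ℂ) • fock (f k) else 0 := by
  simp only [map_sum, map_smul, toTwoMode_single, adjoint_tensorRight_apply, inner_fock, one_smul,
    ite_smul, zero_smul, smul_ite, smul_zero, Finset.sum_ite_eq]

/-! ### The beam splitter orbit -/

/-- The amplitude of `|n - m⟩ ⊗ |m⟩` in the image of `|n⟩ ⊗ |0⟩` under the beam splitter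
rotation with cosine `x` and sine `y`. -/
def lossAmplitude (x y : ℝ) (n m : ℕ) : ℝ := √(n.choose m : ℝ) * x ^ (n - m) * y ^ m

/-- The derivative is kept as a difference `G m - F m`, in the form that `sum_range_telescope`
needs. -/
theorem hasDerivAt_lossAmplitude (n m : ℕ) (t : ℝ) :
    HasDerivAt (fun t => lossAmplitude (Real.cos t) (-Real.sin t) n m)
      (√(n.choose m : ℝ) * ((n - m : ℕ) * Real.cos t ^ (n - m - 1) * (-Real.sin t) ^ (m + 1)) -
        √(n.choose m : ℝ) * (m * Real.cos t ^ (n - m + 1) * (-Real.sin t) ^ (m - 1))) t := by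
  have h1 := ((Real.hasDerivAt_cos t).pow (n - m)).const_mul √(n.choose m : ℝ)
  have h2 := (Real.hasDerivAt_sin t).neg.pow m
  refine (h1.mul h2).congr_deriv ?_
  simp only [Pi.pow_apply, Pi.neg_apply]
  ring

omit [CompleteSpace H] in
theorem beamSplitter_orbit (fock : HilbertBasis ℕ ℂ H) (n : ℕ) {T : ℝ} (hT : 0 ≤ T) :
    unitaryExp (toTwoMode fock) beamSplitterGen T (tensorRight (fock 0) (fock n)) =
      toTwoMode fock (∑ m ∈ Finset.range (n + 1),
        (lossAmplitude (Real.cos T) (-Real.sin T) n m : ℂ) • Finsupp.single (n - m, m) 1) := by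
  have h := (isUnitaryGroupGeneratedBy_beamSplitterGen fock).norm_sub_le (Finset.range (n + 1))
    (fun m => Finsupp.single (n - m, m) 1)
    (fun m t => lossAmplitude (Real.cos t) (-Real.sin t) n m) _ (ε := 0) hT
    (fun m _ t _ => hasDerivAt_lossAmplitude n m t) fun t _ => ?_
  · rw [zero_mul] at h
    have h2 := sub_eq_zero.1 (norm_eq_zero.1 (le_antisymm h (norm_nonneg _)))
    rw [h2]
    congr 1
    rw [Finset.sum_eq_single 0]
    · simp [lossAmplitude, toTwoMode_single]
    · intro m _ hm
      simp [lossAmplitude, hm]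
    · simp
  · set x := Real.cos t
    set y := -Real.sin t
    rw [sum_range_telescope beamSplitterGen (fun m => Finsupp.single (n - m, m) 1)
      (fun m => √(n.choose m : ℝ) * (m * x ^ (n - m + 1) * y ^ (m - 1)))
      (fun m => √(n.choose m : ℝ) * ((n - m : ℕ) * x ^ (n - m - 1) * y ^ (m + 1)))
      (fun m => lossAmplitude x y n m) n]
    -- Both boundary terms vanish at `N = n`: one contains the factor `n - n`, the other `n.choose
    -- (n + 1)`. So the defect is exactly zero.
    · simp
    · simp
    · rw [beamSplitterGen_single]
      rcases n with _ | n
      · simp [lossAmplitude]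
      · simp only [lossAmplitude, Nat.choose_zero_right, Nat.choose_one_right]
        simp only [Nat.cast_one, Real.sqrt_one, one_mul, pow_zero, mul_one, Nat.sub_zero,
          CharP.cast_eq_zero, Real.sqrt_zero, mul_zero, Complex.ofReal_zero, Finsupp.single_zero,
          zero_sub, zero_add, smul_neg, Finsupp.smul_single, smul_eq_mul, Nat.add_sub_cancel,
          Nat.sub_self, neg_inj]
        congr 1
        push_cast
        ring
    · intro m hm
      obtain ⟨r, rfl⟩ := Nat.exists_eq_add_of_lt hm
      rw [beamSplitterGen_single]
      have e1 : m + r + 1 - (m + 1) = r := by omega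
      have e2 : m + r + 1 - m = r + 1 := by omega
      have e3 : m + r + 1 - (m + 2) = r - 1 := by omega
      have i1 : √((m + r + 1).choose (m + 1) : ℝ) * (√((r : ℝ) + 1) * √((m : ℝ) + 1)) =
          √((m + r + 1).choose m : ℝ) * ((r : ℝ) + 1) := by
        rw [mul_comm √((r : ℝ) + 1)]
        refine sqrt_mul_sqrt_mul_sqrt (by positivity) (by positivity) (by positivity) ?_
        have := Nat.choose_succ_right_eq (m + r + 1) m
        rw [e2] at this
        exact_mod_cast this
      have i2 : √((m + r + 1).choose (m + 1) : ℝ) * (√(r : ℝ) * √((m : ℝ) + 1 + 1)) =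
          √((m + r + 1).choose (m + 2) : ℝ) * ((m : ℝ) + 1 + 1) := by
        refine sqrt_mul_sqrt_mul_sqrt (by positivity) (by positivity) (by positivity) ?_
        have := Nat.choose_succ_right_eq (m + r + 1) (m + 1)
        rw [e1] at this
        exact_mod_cast this.symm
      simp only [lossAmplitude, e1, e2, e3, Nat.add_sub_cancel, smul_sub, Finsupp.smul_single,
        smul_eq_mul, one_mul, mul_one]
      push_cast
      congr 2
      · norm_cast
        push_cast
        linear_combination (x ^ r * y ^ (m + 1)) * i1
      · norm_cast
        rcases r with _ | r
        · simp
        · push_cast at i2 ⊢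
          linear_combination (x ^ (r + 1) * y ^ (m + 1)) * i2

theorem vacuumKraus_beamSplitter (fock : HilbertBasis ℕ ℂ H) {lam : ℝ} (h0 : 0 ≤ lam)
    (h1 : lam ≤ 1) (m n : ℕ) : vacuumKraus fock (beamSplitter fock lam) m (fock n) =
      (lossAmplitude √lam (-√(1 - lam)) n m : ℂ) • fock (n - m) := by
  rw [vacuumKraus, beamSplitter, ContinuousLinearMap.comp_apply, ContinuousLinearMap.comp_apply,
    beamSplitter_orbit fock n (Real.arccos_nonneg _), Real.cos_arccos, Real.sin_arccos,
    Real.sq_sqrt h0, adjoint_tensorRight_sum]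
  · split_ifs with hm
    · rfl
    · rw [Finset.mem_range, not_lt] at hm
      simp [lossAmplitude, Nat.choose_eq_zero_of_lt hm]
  · linarith [Real.sqrt_nonneg lam]
  · exact Real.sqrt_le_one.2 h1

/-! ### The two-mode squeezing orbit -/

/-- The amplitude of `|n + k⟩ ⊗ |k⟩` in the image of `|n⟩ ⊗ |0⟩` under the two-mode squeezer with
hyperbolic tangent `x` and hyperbolic cosine `y`. -/
def ampAmplitude (x y : ℝ) (n k : ℕ) : ℝ := √((n + k).choose k : ℝ) * x ^ k / y ^ (n + 1)

theorem hasDerivAt_tanh (t : ℝ) : HasDerivAt Real.tanh (1 - Real.tanh t ^ 2) t := by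
  have h := (Real.hasDerivAt_sinh t).div (Real.hasDerivAt_cosh t) (Real.cosh_pos t).ne'
  have hc := (Real.cosh_pos t).ne'
  have h2 : Real.tanh = fun t => Real.sinh t / Real.cosh t := funext Real.tanh_eq_sinh_div_cosh
  rw [h2]
  refine h.congr_deriv ?_
  field_simp

theorem monotone_tanh : Monotone Real.tanh := by
  refine monotone_of_hasDerivAt_nonneg hasDerivAt_tanh fun t => ?_
  have h1 := Real.tanh_lt_one t
  have h2 := Real.neg_one_lt_tanh t
  simp only [Pi.zero_apply]
  nlinarith

theorem hasDerivAt_ampAmplitude (n k : ℕ) (t : ℝ) :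
    HasDerivAt (fun t => ampAmplitude (Real.tanh t) (Real.cosh t) n k)
      (-(√((n + k).choose k : ℝ) * ((n + k + 1) * Real.tanh t ^ (k + 1) / Real.cosh t ^ (n + 1))) -
        -(√((n + k).choose k : ℝ) * (k * Real.tanh t ^ (k - 1) / Real.cosh t ^ (n + 1)))) t := by
  have hc := (Real.cosh_pos t).ne'
  have h1 := ((hasDerivAt_tanh t).pow k).const_mul √((n + k).choose k : ℝ)
  have h2 := (Real.hasDerivAt_cosh t).pow (n + 1)
  have hs : Real.sinh t = Real.tanh t * Real.cosh t := by
    rw [Real.tanh_eq_sinh_div_cosh]; field_simp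
  refine (h1.div h2 (pow_ne_zero _ hc)).congr_deriv ?_
  simp only [Pi.pow_apply, hs, Nat.add_sub_cancel]
  rcases k with _ | k
  · simp only [CharP.cast_eq_zero, zero_mul, mul_zero]
    push_cast
    field_simp
    ring
  · simp only [Nat.add_sub_cancel]
    push_cast
    field_simp
    ring

/-- The coefficient equals `(n + 1)` times `(N + n + 1).choose (n + 1)`, so this is a multiple of
the general term of a convergent power series. -/
theorem tendsto_choose_mul_pow {q : ℝ} (hq : |q| < 1) (n : ℕ) :
    Tendsto (fun N : ℕ => ((n + N).choose N : ℝ) * (n + N + 1) * q ^ N) atTop (𝓝 0) := by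
  have h1 := (summable_choose_mul_geometric_of_norm_lt_one (n + 1)
    (by rwa [Real.norm_eq_abs] : ‖q‖ < 1)).tendsto_atTop_zero.const_mul ((n : ℝ) + 1)
  rw [mul_zero] at h1
  refine h1.congr fun N => ?_
  have h2 := Nat.add_one_mul_choose_eq (N + n) n
  rw [show (n + N).choose N = (N + n).choose n by
    rw [add_comm, Nat.choose_symm_add]]
  have h3 : ((N : ℝ) + n + 1) * ((N + n).choose n : ℝ) =
      ((N + (n + 1)).choose (n + 1) : ℝ) * (n + 1) := by exact_mod_cast h2
  linear_combination -(q ^ N) * h3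

theorem tanh_nonneg {t : ℝ} (ht : 0 ≤ t) : 0 ≤ Real.tanh t := by
  rw [Real.tanh_eq_sinh_div_cosh]
  exact div_nonneg (Real.sinh_nonneg_iff.2 ht) (Real.cosh_pos t).le

omit [CompleteSpace H] in
theorem squeezing_orbit (fock : HilbertBasis ℕ ℂ H) (n : ℕ) {T : ℝ} (hT : 0 ≤ T) :
    Tendsto (fun N => toTwoMode fock (∑ k ∈ Finset.range (N + 1),
        (ampAmplitude (Real.tanh T) (Real.cosh T) n k : ℂ) • Finsupp.single (n + k, k) 1)) atTop
      (𝓝 (unitaryExp (toTwoMode fock) squeezingGen T (tensorRight (fock 0) (fock n)))) := by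
  set q := Real.tanh T
  have hq0 : 0 ≤ q := tanh_nonneg hT
  have hq1 : q < 1 := Real.tanh_lt_one T
  have hmono : ∀ t ∈ Set.Icc 0 T, Real.tanh t ≤ q := fun t ht => monotone_tanh ht.2
  -- The factor `2` counts the two boundary terms at the cut. Each is bounded uniformly on `[0, T]`,
  -- because `tanh t ≤ tanh T = q < 1` and `cosh t ≥ 1`.
  have key : ∀ N, ‖toTwoMode fock (∑ k ∈ Finset.range (N + 1),
        (ampAmplitude (Real.tanh T) (Real.cosh T) n k : ℂ) • Finsupp.single (n + k, k) 1) -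
      unitaryExp (toTwoMode fock) squeezingGen T (tensorRight (fock 0) (fock n))‖ ≤
      2 * (((n + N).choose N : ℝ) * (n + N + 1) * q ^ N) * T := fun N => by
    have h := (isUnitaryGroupGeneratedBy_squeezingGen fock).norm_sub_le (Finset.range (N + 1))
      (fun k => Finsupp.single (n + k, k) 1)
      (fun k t => ampAmplitude (Real.tanh t) (Real.cosh t) n k) _
      (ε := 2 * (((n + N).choose N : ℝ) * (n + N + 1) * q ^ N)) hT
      (fun k _ t _ => hasDerivAt_ampAmplitude n k t) fun t ht => ?_
    · refine le_trans (le_of_eq ?_) h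
      congr 4
      rw [Finset.sum_eq_single 0]
      · simp [ampAmplitude, toTwoMode_single]
      · intro m _ hm
        simp [ampAmplitude, hm]
      · simp
    · have hx0 : 0 ≤ Real.tanh t := tanh_nonneg ht.1
      have hxq := hmono t ht
      have hy1 : 1 ≤ Real.cosh t := Real.one_le_cosh t
      set x := Real.tanh t
      set y := Real.cosh t
      have i1 : ∀ k : ℕ, √((n + k).choose k : ℝ) * (√((n : ℝ) + k + 1) * √((k : ℝ) + 1)) =
          √((n + (k + 1)).choose (k + 1) : ℝ) * ((k : ℝ) + 1) := fun k => by
        refine sqrt_mul_sqrt_mul_sqrt (by positivity) (by positivity) (by positivity) ?_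
        have := Nat.add_one_mul_choose_eq (n + k) k
        rw [mul_comm] at this
        exact_mod_cast this
      have i2 : ∀ k : ℕ, √((n + (k + 1)).choose (k + 1) : ℝ) *
          (√((k : ℝ) + 1) * √((n : ℝ) + k + 1)) =
          √((n + k).choose k : ℝ) * ((n : ℝ) + k + 1) := fun k => by
        refine sqrt_mul_sqrt_mul_sqrt (by positivity) (by positivity) (by positivity) ?_
        have := Nat.add_one_mul_choose_eq (n + k) k
        rw [mul_comm] at this
        exact_mod_cast this.symm
      rw [sum_range_telescope squeezingGen (fun k => Finsupp.single (n + k, k) 1)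
        (fun k => -(√((n + k).choose k : ℝ) * (k * x ^ (k - 1) / y ^ (n + 1))))
        (fun k => -(√((n + k).choose k : ℝ) * ((n + k + 1) * x ^ (k + 1) / y ^ (n + 1))))
        (fun k => ampAmplitude x y n k) N]
      · rw [map_add, map_smul, map_smul]
        refine (norm_add_le _ _).trans ?_
        rw [norm_smul, norm_smul, norm_toTwoMode_single, norm_toTwoMode_single, Complex.norm_real,
          Complex.norm_real, norm_neg, norm_neg, norm_one, mul_one, mul_one,
          Real.norm_of_nonneg (by positivity), Real.norm_of_nonneg (by positivity)]
        have hC : √((n + N).choose N : ℝ) ≤ ((n + N).choose N : ℝ) := by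
          have : (1 : ℝ) ≤ ((n + N).choose N : ℝ) := by
            exact_mod_cast Nat.choose_pos (Nat.le_add_left _ _)
          rw [Real.sqrt_le_left (by positivity)]
          nlinarith
        have hpow : ∀ z : ℝ, 0 ≤ z → z / y ^ (n + 1) ≤ z := fun z hz =>
          div_le_self hz (one_le_pow₀ hy1)
        have hxN : x ^ N ≤ q ^ N := by gcongr
        have b1 : √((n + N).choose N : ℝ) * ((n + N + 1) * x ^ (N + 1) / y ^ (n + 1)) ≤
            ((n + N).choose N : ℝ) * (n + N + 1) * q ^ N := by
          rw [mul_assoc ((n + N).choose N : ℝ)]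
          gcongr
          refine (hpow _ (by positivity)).trans ?_
          gcongr
          rw [pow_succ]
          exact (mul_le_of_le_one_right (by positivity) (hxq.trans hq1.le)).trans hxN
        have b2 : √((n + (N + 1)).choose (N + 1) : ℝ) *
            ((N + 1 : ℕ) * x ^ (N + 1 - 1) / y ^ (n + 1)) ≤
            ((n + N).choose N : ℝ) * (n + N + 1) * q ^ N := by
          rw [Nat.add_sub_cancel, mul_div_assoc, ← mul_assoc]
          push_cast
          rw [← i1]
          gcongr
          · refine (sqrt_mul_sqrt_le (by positivity) (by positivity)).trans ?_
            linarith [(n.cast_nonneg : (0 : ℝ) ≤ n)]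
          · exact (hpow _ (by positivity)).trans hxN
        linarith
      · simp
      · have h1 := i1 0
        simp only [CharP.cast_eq_zero, add_zero, zero_add] at h1
        have e1 : ampAmplitude x y n 0 * (√((n : ℝ) + 1) * √(1 : ℝ)) =
            √((n + 1).choose 1 : ℝ) * ((1 : ℕ) * x ^ (1 - 1) / y ^ (n + 1)) := by
          rw [ampAmplitude, add_zero, Nat.sub_self, Nat.cast_one]
          linear_combination (1 / y ^ (n + 1)) * h1
        rw [squeezingGen_single, Complex.ofReal_neg, neg_smul, neg_neg, ← e1]
        simp
      · intro k _
        have e1 : ampAmplitude x y n (k + 1) *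
            (√(((n + (k + 1) : ℕ) : ℝ) + 1) * √(((k + 1 : ℕ) : ℝ) + 1)) =
            √((n + (k + 2)).choose (k + 2) : ℝ) *
              ((k + 2 : ℕ) * x ^ (k + 2 - 1) / y ^ (n + 1)) := by
          have h1 := i1 (k + 1)
          rw [ampAmplitude, show k + 2 - 1 = k + 1 by omega]
          push_cast at h1 ⊢
          rw [show (n : ℝ) + (k + 1) + 1 = n + (k + 1) + 1 by ring]
          linear_combination (x ^ (k + 1) / y ^ (n + 1)) * h1
        have e2 : ampAmplitude x y n (k + 1) *
            (√((n + (k + 1) : ℕ) : ℝ) * √((k + 1 : ℕ) : ℝ)) =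
            √((n + k).choose k : ℝ) * ((n + k + 1) * x ^ (k + 1) / y ^ (n + 1)) := by
          have h1 := i2 k
          rw [ampAmplitude]
          push_cast
          rw [← add_assoc (n : ℝ)]
          linear_combination (x ^ (k + 1) / y ^ (n + 1)) * h1
        rw [squeezingGen_single, ← e1, ← e2]
        simp only [smul_sub, Finsupp.smul_single, smul_eq_mul, one_mul, mul_one,
          Complex.ofReal_neg, Complex.ofReal_mul, Finsupp.single_neg, Nat.add_sub_cancel]
        rw [sub_neg_eq_add, sub_eq_neg_add]
        rfl
  have hlim := ((tendsto_choose_mul_pow (by rwa [abs_of_nonneg hq0]) n).const_mul 2).mul_const T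
  rw [mul_zero, zero_mul] at hlim
  exact tendsto_iff_norm_sub_tendsto_zero.2 (squeeze_zero (fun _ => norm_nonneg _) key hlim)

theorem vacuumKraus_twoModeSqueezer (fock : HilbertBasis ℕ ℂ H) {g : ℝ} (hg : 1 ≤ g) (k n : ℕ) :
    vacuumKraus fock (twoModeSqueezer fock g) k (fock n) =
      (ampAmplitude √((g - 1) / g) √g n k : ℂ) • fock (n + k) := by
  have hs : 1 ≤ √g := Real.one_le_sqrt.2 hg
  have hlim := squeezing_orbit fock n (Real.arcosh_nonneg hs)
  rw [Real.cosh_arcosh hs, Real.tanh_arcosh hs, Real.sq_sqrt (by linarith),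
    ← Real.sqrt_div (by linarith)] at hlim
  have h2 := ((tensorRight (fock k)).adjoint.continuous.tendsto _).comp hlim
  refine tendsto_nhds_unique h2 (tendsto_const_nhds.congr' ?_)
  -- The projection to `|k⟩` of the environment does not change once `N ≥ k`, so its limit is the
  -- `k`-th amplitude.
  filter_upwards [eventually_ge_atTop k] with N hN
  rw [Function.comp_apply, adjoint_tensorRight_sum, if_pos]
  exact Finset.mem_range.2 (by omega)

/-! ### The Kraus expressions on Fock states -/

theorem sqrt_pow {x : ℝ} (hx : 0 ≤ x) (n : ℕ) : √(x ^ n) = √x ^ n := by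
  rw [Real.sqrt_eq_iff_mul_self_eq (by positivity) (by positivity), ← mul_pow,
    Real.mul_self_sqrt hx]

theorem numberPow_single (x : ℝ) (n : ℕ) (c : ℂ) :
    numberPow x (Finsupp.single n c) = Finsupp.single n (c * (x ^ n : ℝ)) := by
  simp [numberPow]

theorem annihilate_pow_single (m n : ℕ) (c : ℂ) :
    (annihilate ^ m) (Finsupp.single n c) =
      Finsupp.single (n - m) (c * (√(n.descFactorial m : ℝ) : ℝ)) := by
  induction m with
  | zero => simp
  | succ m ih =>
    rw [pow_succ', Module.End.mul_apply, ih, Nat.descFactorial_succ, Nat.cast_mul,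
      Real.sqrt_mul (by positivity)]
    simp only [annihilate, Finsupp.linearCombination_single, Finsupp.smul_single, smul_eq_mul]
    push_cast
    rw [Nat.sub_sub]
    congr 1
    ring

theorem create_pow_single (k n : ℕ) (c : ℂ) :
    (create ^ k) (Finsupp.single n c) =
      Finsupp.single (n + k) (c * (√((n + 1).ascFactorial k : ℝ) : ℝ)) := by
  induction k with
  | zero => simp
  | succ k ih =>
    rw [pow_succ', Module.End.mul_apply, ih, Nat.ascFactorial_succ, Nat.cast_mul,
      Real.sqrt_mul (by positivity)]
    simp only [create, Finsupp.linearCombination_single, Finsupp.smul_single, smul_eq_mul]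
    push_cast
    rw [add_assoc, show (n : ℝ) + 1 + k = n + k + 1 by ring]
    congr 1
    ring

theorem pureLossExpr_single {lam : ℝ} (h1 : lam ≤ 1) (m n : ℕ) :
    pureLossExpr lam m (Finsupp.single n 1) =
      Finsupp.single (n - m) (lossAmplitude √lam √(1 - lam) n m : ℂ) := by
  rw [pureLossExpr, LinearMap.smul_apply, Module.End.mul_apply, annihilate_pow_single,
    numberPow_single, Finsupp.smul_single, smul_eq_mul, one_mul, ← Complex.ofReal_mul,
    ← Complex.ofReal_mul]
  congr 2
  have hm : (m.factorial : ℝ) ≠ 0 := by exact_mod_cast m.factorial_ne_zero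
  have h2 : √((1 - lam) ^ m / m.factorial) * √(n.descFactorial m : ℝ) =
      √(n.choose m : ℝ) * √(1 - lam) ^ m := by
    rw [← Real.sqrt_mul (div_nonneg (pow_nonneg (by linarith) _) (by positivity)),
      ← sqrt_pow (by linarith), ← Real.sqrt_mul (by positivity),
      Nat.descFactorial_eq_factorial_mul_choose]
    congr 1
    push_cast
    field_simp
  rw [lossAmplitude]
  linear_combination √lam ^ (n - m) * h2

theorem pureAmpExpr_single {g : ℝ} (hg : 1 ≤ g) (k n : ℕ) :
    pureAmpExpr g k (Finsupp.single n 1) =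
      Finsupp.single (n + k) (ampAmplitude √((g - 1) / g) √g n k : ℂ) := by
  rw [pureAmpExpr, LinearMap.smul_apply, Module.End.mul_apply, numberPow_single, create_pow_single,
    Finsupp.smul_single, smul_eq_mul, one_mul, ← Complex.ofReal_mul, ← Complex.ofReal_mul]
  congr 2
  have hs : √g ≠ 0 := (Real.sqrt_pos.2 (by linarith)).ne'
  have hk : √(k.factorial : ℝ) ≠ 0 := (Real.sqrt_pos.2 (by positivity)).ne'
  rw [ampAmplitude, Nat.ascFactorial_eq_factorial_mul_choose, Nat.cast_mul,
    Real.sqrt_mul (by positivity), Real.sqrt_mul (by linarith), one_div, one_div, mul_inv, inv_pow]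
  field_simp
  ring

theorem create_pow_mul_annihilate_pow (x y : ℝ) (k m : ℕ) :
    create ^ k * numberPow x * (numberPow y * annihilate ^ m) =
      create ^ k * numberPow (x * y) * annihilate ^ m := by
  have h : numberPow x * numberPow y = numberPow (x * y) := by
    refine Finsupp.lhom_ext fun n c => ?_
    rw [Module.End.mul_apply, numberPow_single, numberPow_single, numberPow_single, mul_pow]
    congr 1
    push_cast
    ring
  rw [← h]
  simp only [mul_assoc]

theorem pureAmpExpr_mul_pureLossExpr {g lam : ℝ} (h1 : lam ≤ 1) (hg : 1 ≤ g)
    (k m : ℕ) : pureAmpExpr g k * pureLossExpr lam m = compExpr g lam k m := by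
  have hg0 : 0 < g := by linarith
  have hlam : 0 ≤ 1 - lam := by linarith
  rw [pureAmpExpr, pureLossExpr, compExpr, smul_mul_smul_comm, create_pow_mul_annihilate_pow,
    ← Complex.ofReal_mul, one_div_mul_eq_div √g, ← Real.sqrt_div' _ hg0.le]
  congr 3
  have hk : √(k.factorial : ℝ) ≠ 0 := (Real.sqrt_pos.2 (by positivity)).ne'
  have hm : √(m.factorial : ℝ) ≠ 0 := (Real.sqrt_pos.2 (by positivity)).ne'
  have hs : √g ≠ 0 := (Real.sqrt_pos.2 hg0).ne'
  rw [Real.sqrt_mul hg0.le, Real.sqrt_div (by linarith), Real.sqrt_div (by positivity),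
    Real.sqrt_div (mul_nonneg (pow_nonneg (by linarith) _) (by positivity)),
    Real.sqrt_mul (pow_nonneg (by linarith) _), Real.sqrt_mul (by positivity),
    Real.sqrt_mul (by positivity), sqrt_pow (x := g - 1) (by linarith), sqrt_pow hlam,
    sqrt_pow hg0.le, div_pow]
  field_simp
  ring

/-! ### The Kraus operators -/

variable (fock : HilbertBasis ℕ ℂ H)

omit [CompleteSpace H] in
theorem apply_toMode_eq_of_fock {B : H →L[ℂ] H} {X : (ℕ →₀ ℂ) →ₗ[ℂ] (ℕ →₀ ℂ)}
    (h : ∀ n, B (fock n) = toMode fock (X (Finsupp.single n 1))) (v : ℕ →₀ ℂ) :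
    B (toMode fock v) = toMode fock (X v) := by
  induction v using Finsupp.induction_linear with
  | zero => simp
  | add v w hv hw => simp only [map_add, hv, hw]
  | single n c =>
    rw [toMode_single, map_smul, h, ← map_smul, ← map_smul, Finsupp.smul_single, smul_eq_mul,
      mul_one]

/-- No norm estimate for `X` is needed: a bounded `B` agreeing with it on Fock states supplies the
bound that makes the extension meaningful, and density gives uniqueness. -/
theorem boundedExtension_eq {B : H →L[ℂ] H} {X : (ℕ →₀ ℂ) →ₗ[ℂ] (ℕ →₀ ℂ)}
    (h : ∀ n, B (fock n) = toMode fock (X (Finsupp.single n 1))) :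
    boundedExtension fock X = B := by
  have h1 := apply_toMode_eq_of_fock fock h
  refine LinearMap.extendOfNorm_unique (denseRange_toMode fock) ‖B‖ (fun v => ?_) B
    (LinearMap.ext h1)
  rw [LinearMap.comp_apply, ← h1]
  exact B.le_opNorm _

variable {g lam : ℝ}

/-- The generator `a† b - a b†` sends amplitude into the environment with a minus sign, hence `-sin`
in the orbit and `(-1) ^ m` here. The sign drops out of `K ρ K†`. -/
theorem krausPureLoss_eq (h0 : 0 ≤ lam) (h1 : lam ≤ 1) (m : ℕ) :
    krausPureLoss fock lam m = (-1 : ℂ) ^ m • vacuumKraus fock (beamSplitter fock lam) m := by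
  refine boundedExtension_eq fock fun n => ?_
  rw [smul_apply, vacuumKraus_beamSplitter fock h0 h1,
    pureLossExpr_single h1, toMode_single, smul_smul]
  congr 1
  rw [lossAmplitude, lossAmplitude, neg_pow]
  push_cast
  have : (-1 : ℂ) ^ m * (-1) ^ m = 1 := by rw [← mul_pow]; norm_num
  linear_combination (↑√(n.choose m : ℝ) * (√lam : ℂ) ^ (n - m) * (√(1 - lam) : ℂ) ^ m) * this

theorem krausPureAmp_eq (hg : 1 ≤ g) (k : ℕ) :
    krausPureAmp fock g k = vacuumKraus fock (twoModeSqueezer fock g) k := by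
  refine boundedExtension_eq fock fun n => ?_
  rw [vacuumKraus_twoModeSqueezer fock hg, pureAmpExpr_single hg, toMode_single]

theorem krausPureLoss_fock (h0 : 0 ≤ lam) (h1 : lam ≤ 1) (m n : ℕ) :
    krausPureLoss fock lam m (fock n) =
      (lossAmplitude √lam √(1 - lam) n m : ℂ) • fock (n - m) := by
  rw [krausPureLoss_eq fock h0 h1, smul_apply,
    vacuumKraus_beamSplitter fock h0 h1, smul_smul]
  congr 1
  rw [lossAmplitude, lossAmplitude, neg_pow]
  push_cast
  have : (-1 : ℂ) ^ m * (-1) ^ m = 1 := by rw [← mul_pow]; norm_num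
  linear_combination (↑√(n.choose m : ℝ) * (√lam : ℂ) ^ (n - m) * (√(1 - lam) : ℂ) ^ m) * this

theorem krausPureLoss_toMode (h0 : 0 ≤ lam) (h1 : lam ≤ 1) (m : ℕ) (v : ℕ →₀ ℂ) :
    krausPureLoss fock lam m (toMode fock v) = toMode fock (pureLossExpr lam m v) :=
  apply_toMode_eq_of_fock fock (fun n => by
    rw [krausPureLoss_fock fock h0 h1, pureLossExpr_single h1, toMode_single]) v

theorem krausPureAmp_fock (hg : 1 ≤ g) (k n : ℕ) :
    krausPureAmp fock g k (fock n) = (ampAmplitude √((g - 1) / g) √g n k : ℂ) • fock (n + k) := by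
  rw [krausPureAmp_eq fock hg, vacuumKraus_twoModeSqueezer fock hg]

theorem krausPureAmp_toMode (hg : 1 ≤ g) (k : ℕ) (v : ℕ →₀ ℂ) :
    krausPureAmp fock g k (toMode fock v) = toMode fock (pureAmpExpr g k v) :=
  apply_toMode_eq_of_fock fock (fun n => by
    rw [krausPureAmp_fock fock hg, pureAmpExpr_single hg, toMode_single]) v

theorem isContractiveFamily_krausPureLoss (h0 : 0 ≤ lam) (h1 : lam ≤ 1) :
    IsContractiveFamily (krausPureLoss fock lam) := fun s x => by
  have h := isContractiveFamily_vacuumKraus fock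
    ((isUnitaryGroupGeneratedBy_beamSplitterGen fock).mem_unitary (Real.arccos √lam)) s x
  refine le_trans (le_of_eq (Finset.sum_congr rfl fun m _ => ?_)) h
  rw [krausPureLoss_eq fock h0 h1, smul_apply, norm_smul, norm_pow, norm_neg,
    norm_one, one_pow, one_mul]
  rfl

theorem isContractiveFamily_krausPureAmp (hg : 1 ≤ g) :
    IsContractiveFamily (krausPureAmp fock g) := by
  rw [funext (krausPureAmp_eq fock hg)]
  exact isContractiveFamily_vacuumKraus fock
    ((isUnitaryGroupGeneratedBy_squeezingGen fock).mem_unitary (Real.arcosh √g))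

theorem thermalAttenuator_zero (h0 : 0 ≤ lam) (h1 : lam ≤ 1) (ρ : H →L[ℂ] H) :
    thermalAttenuator fock lam 0 ρ =
      ∑' m, krausPureLoss fock lam m ∘L ρ ∘L (krausPureLoss fock lam m).adjoint := by
  rw [thermalAttenuator, partialTrace_vacuum]
  refine tsum_congr fun m => ?_
  rw [krausPureLoss_eq fock h0 h1]
  have : (-1 : ℂ) ^ m * (-1) ^ m = 1 := by rw [← mul_pow]; norm_num
  rw [map_smulₛₗ]
  simp [smul_smul, this]

theorem thermalAmplifier_zero (hg : 1 ≤ g) (ρ : H →L[ℂ] H) :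
    thermalAmplifier fock g 0 ρ =
      ∑' k, krausPureAmp fock g k ∘L ρ ∘L (krausPureAmp fock g k).adjoint := by
  rw [thermalAmplifier, partialTrace_vacuum]
  simp only [krausPureAmp_eq fock hg]

theorem isContractiveFamily_krausComp (h0 : 0 ≤ lam) (h1 : lam ≤ 1) (hg : 1 ≤ g) :
    IsContractiveFamily fun km : ℕ × ℕ => krausComp fock g lam km.1 km.2 :=
  (isContractiveFamily_krausPureAmp fock hg).prod (isContractiveFamily_krausPureLoss fock h0 h1)

theorem compChannel_eq_tsum (h0 : 0 ≤ lam) (h1 : lam ≤ 1) (hg : 1 ≤ g) {α : Type*} {x y : α → H}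
    {ρ : H →L[ℂ] H} (h : Summable fun a => ‖x a‖ * ‖y a‖)
    (hρ : HasSum (fun a => InnerProductSpace.rankOne ℂ (x a) (y a)) ρ) :
    compChannel fock g lam ρ = ∑' km : ℕ × ℕ, krausComp fock g lam km.1 km.2 ∘L ρ ∘L
      (krausComp fock g lam km.1 km.2).adjoint := by
  rw [compChannel, Function.comp_apply, thermalAmplifier_zero fock hg,
    thermalAttenuator_zero fock h0 h1]
  exact ((isContractiveFamily_krausPureAmp fock hg).tsum_prod_eq
    (isContractiveFamily_krausPureLoss fock h0 h1) h hρ).symm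

/-! ### The action on Fock operators -/

/-- The amplitude of `|n - m + k⟩` in the image of `|n⟩` under a Kraus operator of the
composition. -/
def compAmplitude (g lam : ℝ) (n k m : ℕ) : ℝ :=
  lossAmplitude √lam √(1 - lam) n m * ampAmplitude √((g - 1) / g) √g (n - m) k

theorem compAmplitude_of_lt {n m : ℕ} (h : n < m) (k : ℕ) : compAmplitude g lam n k m = 0 := by
  simp [compAmplitude, lossAmplitude, Nat.choose_eq_zero_of_lt h]

theorem krausComp_fock (h0 : 0 ≤ lam) (h1 : lam ≤ 1) (hg : 1 ≤ g) (k m n : ℕ) :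
    krausComp fock g lam k m (fock n) =
      (compAmplitude g lam n k m : ℂ) • fock (n - m + k) := by
  rw [krausComp, ContinuousLinearMap.comp_apply, krausPureLoss_fock fock h0 h1, map_smul,
    krausPureAmp_fock fock hg, smul_smul, compAmplitude, Complex.ofReal_mul]

theorem rpow_natCast_div_two {x : ℝ} (hx : 0 ≤ x) (a : ℕ) : x ^ ((a : ℝ) / 2) = √x ^ a := by
  rw [Real.rpow_div_two_eq_sqrt _ hx, Real.rpow_natCast]

/-- Here `n` and `i` are the photon numbers left after losing `m`, so no truncated subtraction
remains. Half-integer powers become powers of square roots, and the four binomials combine under one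
root. -/
theorem compAmplitude_mul_compAmplitude (h0 : 0 ≤ lam) (h1 : lam ≤ 1) (hg : 1 ≤ g)
    (n i k m : ℕ) :
    compAmplitude g lam (n + m) k m * compAmplitude g lam (i + m) k m =
      √(((n + m).factorial : ℝ) * ((i + m).factorial : ℝ) * ((i + k).factorial : ℝ) *
        ((n + k).factorial : ℝ)) /
        ((n.factorial : ℝ) * (i.factorial : ℝ) * (m.factorial : ℝ) * (k.factorial : ℝ)) *
      ((g - 1) ^ k * (1 - lam) ^ m * lam ^ (((n + i : ℕ) : ℝ) / 2) /
        (g ^ k * g ^ (((n + i + 2 : ℕ) : ℝ) / 2))) := by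
  have hg0 : 0 < g := by linarith
  have hs : √g ≠ 0 := (Real.sqrt_pos.2 hg0).ne'
  rw [rpow_natCast_div_two h0, rpow_natCast_div_two hg0.le]
  have hc : √((n + m).choose m : ℝ) * √((n + k).choose k : ℝ) *
      (√((i + m).choose m : ℝ) * √((i + k).choose k : ℝ)) =
      √(((n + m).factorial : ℝ) * ((i + m).factorial : ℝ) * ((i + k).factorial : ℝ) *
        ((n + k).factorial : ℝ)) /
        ((n.factorial : ℝ) * (i.factorial : ℝ) * (m.factorial : ℝ) * (k.factorial : ℝ)) := by
    rw [← Real.sqrt_mul (by positivity), ← Real.sqrt_mul (by positivity),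
      ← Real.sqrt_mul (by positivity), eq_div_iff (by positivity),
      ← Real.sqrt_mul_self (show (0 : ℝ) ≤ n.factorial * i.factorial * m.factorial * k.factorial by
        positivity), ← Real.sqrt_mul (by positivity)]
    congr 1
    have hf : ∀ a b : ℕ, ((a + b).factorial : ℝ) =
        ((a + b).choose b : ℝ) * a.factorial * b.factorial := fun a b => by
      exact_mod_cast (Nat.add_choose_mul_factorial_mul_factorial a b).symm
    simp only [hf]
    ring
  have hl : (1 - lam) ^ m = √(1 - lam) ^ m * √(1 - lam) ^ m := by
    rw [← mul_pow, Real.mul_self_sqrt (by linarith)]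
  have hq : (g - 1) ^ k / g ^ k = √((g - 1) / g) ^ k * √((g - 1) / g) ^ k := by
    rw [← mul_pow, Real.mul_self_sqrt (div_nonneg (by linarith) hg0.le), div_pow]
  simp only [compAmplitude, lossAmplitude, ampAmplitude, Nat.add_sub_cancel]
  rw [← hc, hl]
  calc _ = √((n + m).choose m : ℝ) * √((n + k).choose k : ℝ) *
      (√((i + m).choose m : ℝ) * √((i + k).choose k : ℝ)) *
      ((√((g - 1) / g) ^ k * √((g - 1) / g) ^ k) * (√(1 - lam) ^ m * √(1 - lam) ^ m) *
        √lam ^ (n + i) / √g ^ (n + i + 2)) := by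
        field_simp
        ring
    _ = _ := by
        rw [← hq]
        field_simp

/-- The coefficients of the image of a Fock operator as sums over the Kraus operators. -/
theorem fockCoeff_eq_sum (h0 : 0 ≤ lam) (h1 : lam ≤ 1) (hg : 1 ≤ g) {n i l : ℕ} (hl : i ≤ l + n) :
    fockCoeff n i l g lam = ∑ m ∈ Finset.Icc (i - l) (min n i),
      compAmplitude g lam n (l + m - i) m * compAmplitude g lam i (l + m - i) m := by
  refine Finset.sum_congr rfl fun m hm => ?_
  rw [Finset.mem_Icc, le_min_iff] at hm
  obtain ⟨hm1, hm2, hm3⟩ := hm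
  obtain ⟨n, rfl⟩ := Nat.exists_eq_add_of_le' hm2
  obtain ⟨i, rfl⟩ := Nat.exists_eq_add_of_le' hm3
  obtain ⟨k, rfl⟩ : ∃ k, l = i + k := ⟨l - i, by omega⟩
  have e1 : i + k + m - (i + m) = k := by omega
  have e2 : i + k + (n + m) - (i + m) = n + k := by omega
  rw [e1, e2, Nat.add_sub_cancel, Nat.add_sub_cancel,
    compAmplitude_mul_compAmplitude h0 h1 hg]
  have hg0 : 0 < g := by linarith
  rw [← Real.rpow_natCast g k, ← Real.rpow_add hg0]
  congr 3
  · congr 1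
    push_cast
    ring
  · push_cast
    ring

theorem rankOne_krausComp (h0 : 0 ≤ lam) (h1 : lam ≤ 1) (hg : 1 ≤ g) (n i k m : ℕ) :
    InnerProductSpace.rankOne ℂ (krausComp fock g lam k m (fock n))
      (krausComp fock g lam k m (fock i)) =
      ((compAmplitude g lam n k m * compAmplitude g lam i k m : ℝ) : ℂ) •
        ketBra fock (n - m + k) (i - m + k) := by
  rw [krausComp_fock fock h0 h1 hg, krausComp_fock fock h0 h1 hg, ketBra]
  ext v
  simp only [InnerProductSpace.rankOne_apply, smul_apply, inner_smul_left, smul_smul,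
    Complex.conj_ofReal]
  push_cast
  congr 1
  ring

/-- The index of the Fock operator `|l + n - i⟩⟨l|` to which the Kraus operator with indices
`(k, m)` contributes. -/
def fockIndex (n i : ℕ) (p : ℕ × ℕ) : Set.Ici (i - n) :=
  -- For `m ≤ min n i` this is `i - m + k`. The clipping only keeps the index in range for larger
  -- `m`, where the term is zero anyway.
  ⟨i - min p.2 (min n i) + p.1, by simp only [Set.mem_Ici]; omega⟩

theorem fockIndex_eq_iff {n i l : ℕ} (hl : l ∈ Set.Ici (i - n)) (p : ℕ × ℕ) :
    fockIndex n i p = ⟨l, hl⟩ ↔ i - min p.2 (min n i) + p.1 = l := by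
  rw [fockIndex, Subtype.mk.injEq]

theorem hasSum_fockCoeff_smul_ketBra (h0 : 0 ≤ lam) (h1 : lam ≤ 1) (hg : 1 ≤ g) {n i l : ℕ}
    (hl : l ∈ Set.Ici (i - n)) :
    HasSum (Set.indicator (fockIndex n i ⁻¹' {⟨l, hl⟩}) fun p : ℕ × ℕ =>
      InnerProductSpace.rankOne ℂ (krausComp fock g lam p.1 p.2 (fock n))
        (krausComp fock g lam p.1 p.2 (fock i)))
      (((fockCoeff n i l g lam : ℝ) : ℂ) • ketBra fock (l + n - i) l) := by
  have hl' : i - n ≤ l := hl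
  have hf : Function.Injective fun m : ℕ => (l + m - i, m) := fun a b hab => congrArg Prod.snd hab
  rw [fockCoeff_eq_sum h0 h1 hg (by omega), Complex.ofReal_sum, Finset.sum_smul]
  have hsum : ∀ m ∈ Finset.Icc (i - l) (min n i), Set.indicator (fockIndex n i ⁻¹' {⟨l, hl⟩})
      (fun p : ℕ × ℕ => InnerProductSpace.rankOne ℂ (krausComp fock g lam p.1 p.2 (fock n))
        (krausComp fock g lam p.1 p.2 (fock i))) (l + m - i, m) =
      ((compAmplitude g lam n (l + m - i) m * compAmplitude g lam i (l + m - i) m : ℝ) : ℂ) •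
        ketBra fock (l + n - i) l := fun m hm => by
    rw [Finset.mem_Icc, le_min_iff] at hm
    rw [Set.indicator_of_mem, rankOne_krausComp fock h0 h1 hg]
    · rw [show n - m + (l + m - i) = l + n - i by omega, show i - m + (l + m - i) = l by omega]
    · rw [Set.mem_preimage, Set.mem_singleton_iff, fockIndex_eq_iff]
      dsimp only
      omega
  rw [← Finset.sum_congr rfl hsum]
  set I := Set.indicator (fockIndex n i ⁻¹' {⟨l, hl⟩}) fun p : ℕ × ℕ =>
    InnerProductSpace.rankOne ℂ (krausComp fock g lam p.1 p.2 (fock n))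
      (krausComp fock g lam p.1 p.2 (fock i))
  suffices h : HasSum I (∑ p ∈ (Finset.Icc (i - l) (min n i)).map ⟨_, hf⟩, I p) by
    rwa [Finset.sum_map] at h
  -- A pair in the fibre over `l` but outside the listed finite set has `m > n` or `m > i`, since
  -- otherwise `k = l + m - i`. Then more photons are lost than present and one amplitude vanishes.
  refine hasSum_sum_of_ne_finset_zero fun p hp => ?_
  by_cases hπ : fockIndex n i p = ⟨l, hl⟩
  · rw [show I p = _ from Set.indicator_of_mem (Set.mem_preimage.2 hπ) _, rankOne_krausComp fock h0 h1 hg]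
    rw [fockIndex_eq_iff] at hπ
    have h2 : n < p.2 ∨ i < p.2 := by
      by_contra! hcon
      refine hp (Finset.mem_map.2 ⟨p.2, ?_, ?_⟩)
      · rw [Finset.mem_Icc, le_min_iff]
        omega
      · refine Prod.ext ?_ rfl
        simp only [Function.Embedding.coeFn_mk]
        omega
    rcases h2 with h2 | h2 <;> simp [compAmplitude_of_lt h2]
  · exact Set.indicator_of_notMem (fun h => hπ (Set.mem_preimage.1 h)) _

theorem hasTraceNormSum_compChannel_ketBra (h0 : 0 ≤ lam) (h1 : lam ≤ 1) (hg : 1 ≤ g)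
    (n i : ℕ) : HasTraceNormSum fock
      (fun l : Set.Ici (i - n) => ((fockCoeff n i l g lam : ℝ) : ℂ) •
        ketBra fock ((l : ℕ) + n - i) l)
      (compChannel fock g lam (ketBra fock n i)) := by
  have hK := isContractiveFamily_krausComp fock h0 h1 hg
  have hs : Summable fun _ : Unit => ‖fock n‖ * ‖fock i‖ := Summable.of_finite
  have hρ : HasSum (fun _ : Unit => InnerProductSpace.rankOne ℂ (fock n) (fock i))
      (ketBra fock n i) := hasSum_unique _
  -- `|n⟩⟨i|` is a single rank-one operator, so the Kraus series is itself a rank-one series over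
  -- the pairs `(k, m)`, grouped here by output index `l` instead of by Kraus index.
  refine hasTraceNormSum_of_fibers fock (hK.summable_norm_mul_norm (fock n) (fock i))
    (fockIndex n i) (fun l => hasSum_fockCoeff_smul_ketBra fock h0 h1 hg l.2) ?_
  rw [compChannel_eq_tsum fock h0 h1 hg hs hρ]
  exact hK.hasSum_conj_rankOne (fock n) (fock i)

end Bosonic

end

/-! ### The theorem -/

theorem mainTheorem8 {H : Type*} [NormedAddCommGroup H] [InnerProductSpace ℂ H] [CompleteSpace H]
    (fock : HilbertBasis ℕ ℂ H) (g lam : ℝ) (hlam0 : 0 ≤ lam) (hlam1 : lam ≤ 1) (hg : 1 ≤ g) :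
    -- the Kraus operators are bounded operators given by the explicit expressions
    (∀ (k : ℕ) (v : ℕ →₀ ℂ), Bosonic.krausPureAmp fock g k (Bosonic.toMode fock v) =
      Bosonic.toMode fock (Bosonic.pureAmpExpr g k v)) ∧
    (∀ (m : ℕ) (v : ℕ →₀ ℂ), Bosonic.krausPureLoss fock lam m (Bosonic.toMode fock v) =
      Bosonic.toMode fock (Bosonic.pureLossExpr lam m v)) ∧
    (∀ (k m : ℕ) (v : ℕ →₀ ℂ), Bosonic.krausComp fock g lam k m (Bosonic.toMode fock v) =
      Bosonic.toMode fock (Bosonic.compExpr g lam k m v)) ∧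
    -- Kraus representations of the pure amplifier, the pure loss channel and their composition
    (∀ ρ : H →L[ℂ] H, Bosonic.IsTraceClass fock ρ →
      Bosonic.HasTraceNormSum fock
        (fun k : ℕ => Bosonic.krausPureAmp fock g k ∘L ρ ∘L
          (Bosonic.krausPureAmp fock g k).adjoint)
        (Bosonic.thermalAmplifier fock g 0 ρ)) ∧
    (∀ ρ : H →L[ℂ] H, Bosonic.IsTraceClass fock ρ →
      Bosonic.HasTraceNormSum fock
        (fun m : ℕ => Bosonic.krausPureLoss fock lam m ∘L ρ ∘L
          (Bosonic.krausPureLoss fock lam m).adjoint)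
        (Bosonic.thermalAttenuator fock lam 0 ρ)) ∧
    (∀ ρ : H →L[ℂ] H, Bosonic.IsTraceClass fock ρ →
      Bosonic.HasTraceNormSum fock
        (fun km : ℕ × ℕ => Bosonic.krausComp fock g lam km.1 km.2 ∘L ρ ∘L
          (Bosonic.krausComp fock g lam km.1 km.2).adjoint)
        (Bosonic.compChannel fock g lam ρ)) ∧
    -- action on Fock operators; the sum is over all `l ≥ max (i - n) 0`
    (∀ n i : ℕ,
      Bosonic.HasTraceNormSum fock
        (fun l : Set.Ici (i - n) => ((Bosonic.fockCoeff n i l g lam : ℝ) : ℂ) •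
          Bosonic.ketBra fock ((l : ℕ) + n - i) l)
        (Bosonic.compChannel fock g lam (Bosonic.ketBra fock n i))) := by
  have hcomp : ∀ (k m : ℕ) (v : ℕ →₀ ℂ), Bosonic.krausComp fock g lam k m (Bosonic.toMode fock v) =
      Bosonic.toMode fock (Bosonic.compExpr g lam k m v) := fun k m v => by
    rw [Bosonic.krausComp, ContinuousLinearMap.comp_apply,
      Bosonic.krausPureLoss_toMode fock hlam0 hlam1, Bosonic.krausPureAmp_toMode fock hg,
      ← Bosonic.pureAmpExpr_mul_pureLossExpr hlam1 hg, Module.End.mul_apply]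
  refine ⟨Bosonic.krausPureAmp_toMode fock hg, Bosonic.krausPureLoss_toMode fock hlam0 hlam1,
    hcomp, fun ρ hρ => ?_, fun ρ hρ => ?_, fun ρ hρ => ?_,
    Bosonic.hasTraceNormSum_compChannel_ketBra fock hlam0 hlam1 hg⟩
  · obtain ⟨x, y, hxy, hsum⟩ := hρ.exists_hasSum
    rw [Bosonic.thermalAmplifier_zero fock hg]
    exact (Bosonic.isContractiveFamily_krausPureAmp fock hg).hasTraceNormSum fock hxy hsum
  · obtain ⟨x, y, hxy, hsum⟩ := hρ.exists_hasSum
    rw [Bosonic.thermalAttenuator_zero fock hlam0 hlam1]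
    exact (Bosonic.isContractiveFamily_krausPureLoss fock hlam0 hlam1).hasTraceNormSum fock hxy hsum
  · obtain ⟨x, y, hxy, hsum⟩ := hρ.exists_hasSum
    rw [Bosonic.compChannel_eq_tsum fock hlam0 hlam1 hg hxy hsum]
    exact (Bosonic.isContractiveFamily_krausComp fock hlam0 hlam1 hg).hasTraceNormSum fock hxy hsum
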